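/- **Setting.** Let $(\mathcal C,T,p,0,+,\ell,c)$ be a tangent category (Rosický/Cockett–Cruttwell): an endofunctor $T$ with natural transformations $p:T\Rightarrow \mathrm{id}$, $0:\mathrm{id}\Rightarrow T$, $+:T_2\Rightarrow T$ (where $T_2M=TM\times_M TM$), $\ell:T\Rightarrow T^2$, $c:T^2\Rightarrow T^2$ satisfying the usual axioms. A *$T$-limit* is a limit cone that every $T^n$, $n\ge 0$, sends to a limit cone. Assume that $\mathcal C$ has all $T$-equalizers and all $T$-pullbacks. A *pre-differential bundle* in $\mathcal C$ consists of a lift, that is a morphism $\lambda:E\to TE$ with $T\lambda\circ\lambda=\ell_E\circ\lambda$, together with a splitting $q:E\to M$, $\xi:M\to E$ of the idempotent $e=p_E\circ\lambda$ (so $q\xi=\mathrm{id}_M$ and $\xi q=e$). A morphism $(E,\lambda)\to(E',\lambda')$ is a morphism $f:E\to E'$ of $\mathcal C$ with $\lambda' f=T f\circ\lambda$; this gives the category $\mathrm{Pre}(\mathcal C)$. A *differential bundle* is a pre-differential bundle such that $\lambda$ is the $T$-equalizer of $p_{TE}\circ\ell_E,\ T(p_E\circ\lambda):TE\rightrightarrows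 TE$ and the $T$-pullback powers of $q$ exist. Let $\mathrm{DBun}(\mathcal C)\subseteq\mathrm{Pre}(\mathcal C)$ be the full subcategory of differential bundles. Let $\mathrm{Weil}_1$ be the monoidal category of the commutative rigs $W_{n_1}\otimes\dots\otimes W_{n_k}$, where $W_n=\mathbb N[x_1,\dots,x_n]/(x_ix_j)_{i,j}$, with all rig morphisms, and write $W=W_1=\mathbb N[x]/x^2$. Its *transverse squares* are the squares obtained by applying $U\otimes-\otimes V$ to the pullback squares $W_{n+m}=W_n\times_{\mathbb N}W_m$ and $W_2=(W\otimes W)\times_W\mathbb N$ (and the squares of identities). Let $\mathcal W$ be the cartesian category of Weil spaces, i.e. of functors $\mathrm{Weil}_1\to\mathrm{Set}$ that send transverse squares to pullbacks. For any action $V\mapsto T^V$ of $\mathrm{Weil}_1$ on $\mathcal C$ that preserves transverse squares and presents the tangent structure ($T^{W}\cong T$, with $p,0,+,\ell,c$ induced by the morphisms of Weil algebras $x\mapsto 0$, $\mathbb N\to W$, $W_2\to W$ with $x_i\mapsto x$, $x\mapsto x\otimes x$, and the symmetry), $\mathcal C$ is a $\mathcal W$-category with $\mathcal C(A,B)(V)=\mathcal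 C(A,T^VB)$. Let $\Lambda^+$ be the $\mathcal W$-category with two objects $0,1$, with $\Lambda^+(1,1)=D+1$, where $D=\mathrm{Weil}_1(W,-)$ is the Weil space of elements of square zero with its multiplication and $+1$ adjoins a unit, with all the other hom-objects terminal, and where the composite $1\to0\to1$ is the zero of $D$. Let $[\Lambda^+,\mathcal C]$ be the category of $\mathcal W$-functors $\Lambda^+\to\mathcal C$ and $\mathcal W$-natural transformations. **Proposition.** 1. $\mathrm{DBun}(\mathcal C)$ is a reflective subcategory of $\mathrm{Pre}(\mathcal C)$. The reflection of $(E,\lambda,q,\xi)$ has as total space the $T$-equalizer $\iota:E'\to TE$ of $$T\lambda,\ \ell_E:\ TE\rightrightarrows T^2E,$$ its lift $\lambda'$ is the restriction of $\ell_E$ (that is $T\iota\circ\lambda'=\ell_E\circ\iota$), and the unit $\eta:E\to E'$ is induced by $\lambda$ (that is $\iota\circ\eta=\lambda$). The induced monad $R$ on $\mathrm{Pre}(\mathcal C)$ is idempotent, its category of algebras is $\mathrm{DBun}(\mathcal C)$ (the comparison functor is an equivalence, and a pre-differential bundle carries an algebra structure if and only if it is a differential bundle), and $R$ is left exact: it takes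 finite cones whose cones of total spaces are $T$-limits to such cones, and it preserves pullbacks, equalizers and terminal objects. 2. For every such action of $\mathrm{Weil}_1$ on $\mathcal C$, the functor $[\Lambda^+,\mathcal C]\to\mathrm{Pre}(\mathcal C)$ that sends $F$ to $E=F(1)$, $M=F(0)$, with $q$ and $\xi$ the images of the morphisms $1\to0$ and $0\to1$ and $\lambda$ the image of the generic element of $D\subset D+1$, and that sends a $\mathcal W$-natural transformation to its component at $1$, is an isomorphism of categories. Through it $\mathrm{DBun}(\mathcal C)$ is a reflective subcategory of $[\Lambda^+,\mathcal C]$, with the same description of the reflector, the monad and the algebras as in 1. -/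

import Mathlib

open CategoryTheory MonoidalCategory Limits

universe v u

/-- A shape `[n₀, …, n_{k-1}]`, presenting the Weil algebra `W_{n₀} ⊗ ⋯ ⊗ W_{n_{k-1}}`. -/
structure Weil1 : Type where
  shape : List ℕ

namespace Weil1

/-- The variables `x_{i,j}` with `i < k` and `j < n_i`. -/
abbrev Var (V : Weil1) : Type := {a : ℕ × ℕ // a.2 < V.shape.getD a.1 0}

/-- The relations `x_{i,j} x_{i,k} = 0`. -/
inductive Rel (V : Weil1) : MvPolynomial (Var V) ℕ → MvPolynomial (Var V) ℕ → Prop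
  | mk (a b : Var V) (h : a.1.1 = b.1.1) : Rel V (MvPolynomial.X a * MvPolynomial.X b) 0

/-- The rig `ℕ[x_{i,j}] / (x_{i,j} x_{i,k})`. -/
def Alg (V : Weil1) : Type := RingQuot (Rel V)

noncomputable instance (V : Weil1) : CommSemiring (Alg V) := inferInstanceAs (CommSemiring (RingQuot (Rel V)))

/-- The quotient map from the polynomial rig. -/
noncomputable def quot (V : Weil1) : MvPolynomial (Var V) ℕ →+* Alg V := RingQuot.mkRingHom (Rel V)

/-- The class of the variable `x_{i,j}`, with the convention that it is zero if the indices are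
out of range. -/
noncomputable def gen (V : Weil1) (i j : ℕ) : Alg V :=
  if h : j < V.shape.getD i 0 then quot V (MvPolynomial.X ⟨(i, j), h⟩) else 0

theorem gen_eq_zero {V : Weil1} {i j : ℕ} (h : ¬ j < V.shape.getD i 0) : gen V i j = 0 :=
  dif_neg h

theorem gen_mul_gen (V : Weil1) (i j k : ℕ) : gen V i j * gen V i k = 0 := by
  unfold gen
  split_ifs with h₁ h₂
  · rw [← map_mul]
    exact (RingQuot.mkRingHom_rel (Rel.mk ⟨(i, j), h₁⟩ ⟨(i, k), h₂⟩ rfl)).trans (map_zero (quot V))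
  all_goals simp

theorem ringHom_ext {V : Weil1} {R : Type*} [CommSemiring R] {f g : Alg V →+* R}
    (h : ∀ i j, j < V.shape.getD i 0 → f (gen V i j) = g (gen V i j)) : f = g := by
  have key : f.comp (quot V) = g.comp (quot V) → f = g := RingQuot.ringQuot_ext f g
  apply key
  apply MvPolynomial.ringHom_ext
  · intro n
    simp
  · rintro ⟨⟨i, j⟩, hij⟩
    have := h i j hij
    unfold gen at this
    rw [dif_pos hij] at this
    simpa using this

/-- The universal property of the presentation. -/
noncomputable def lift (V : Weil1) {R : Type*} [CommSemiring R] (x : ℕ → ℕ → R)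
    (hx : ∀ i j k, x i j * x i k = 0) : Alg V →+* R :=
  RingQuot.lift ⟨MvPolynomial.eval₂Hom (Nat.castRingHom R) fun a : Var V => x a.1.1 a.1.2, by
    rintro _ _ ⟨⟨⟨i, j⟩, hij⟩, ⟨⟨i', k⟩, hik⟩, h⟩
    obtain rfl : i = i' := h
    simpa using hx i j k⟩

theorem lift_gen (V : Weil1) {R : Type*} [CommSemiring R] (x : ℕ → ℕ → R)
    (hx : ∀ i j k, x i j * x i k = 0) {i j : ℕ} (h : j < V.shape.getD i 0) :
    lift V x hx (gen V i j) = x i j := by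
  unfold gen
  rw [dif_pos h]
  refine (RingQuot.lift_mkRingHom_apply _ _ _).trans ?_
  simp

/-- Morphisms of Weil algebras are all morphisms of commutative rigs. -/
@[ext]
structure Hom (U V : Weil1) : Type where
  toRingHom : Alg U →+* Alg V

noncomputable instance : Category Weil1 where
  Hom := Hom
  id V := ⟨RingHom.id _⟩
  comp f g := ⟨g.toRingHom.comp f.toRingHom⟩

/-- The morphism `U ⟶ V` with `x_{i,j} ↦ x i j`. -/
noncomputable def mkHom (U V : Weil1) (x : ℕ → ℕ → Alg V) (hx : ∀ i j k, x i j * x i k = 0) :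
    U ⟶ V := ⟨lift U x hx⟩

/-- The action of a morphism on elements. -/
noncomputable def Hom.val {U V : Weil1} (f : U ⟶ V) (a : Alg U) : Alg V := f.toRingHom a

theorem hom_ext {U V : Weil1} {f g : U ⟶ V}
    (h : ∀ i j, j < U.shape.getD i 0 → f.val (gen U i j) = g.val (gen U i j)) : f = g :=
  Hom.ext (ringHom_ext h)

@[simp] theorem id_val {U : Weil1} (a : Alg U) : Hom.val (𝟙 U) a = a := rfl

@[simp] theorem comp_val {U V X : Weil1} (f : U ⟶ V) (g : V ⟶ X) (a : Alg U) :
    Hom.val (f ≫ g) a = g.val (f.val a) := rfl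

@[simp] theorem val_zero {U V : Weil1} (f : U ⟶ V) : f.val 0 = 0 := map_zero f.toRingHom
@[simp] theorem val_one {U V : Weil1} (f : U ⟶ V) : f.val 1 = 1 := map_one f.toRingHom
@[simp] theorem val_mul {U V : Weil1} (f : U ⟶ V) (a b : Alg U) :
    f.val (a * b) = f.val a * f.val b := map_mul f.toRingHom a b
@[simp] theorem val_add {U V : Weil1} (f : U ⟶ V) (a b : Alg U) :
    f.val (a + b) = f.val a + f.val b := map_add f.toRingHom a b

theorem mkHom_gen {U V : Weil1} {x : ℕ → ℕ → Alg V} {hx : ∀ i j k, x i j * x i k = 0} {i j : ℕ}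
    (h : j < U.shape.getD i 0) : (mkHom U V x hx).val (gen U i j) = x i j :=
  lift_gen U x hx h

/-! ### The tensor product -/

noncomputable def tensor (U V : Weil1) : Weil1 := ⟨U.shape ++ V.shape⟩

noncomputable def unit : Weil1 := ⟨[]⟩

theorem getD_left {U V : Weil1} {i : ℕ} (h : i < U.shape.length) :
    (tensor U V).shape.getD i 0 = U.shape.getD i 0 := by
  exact List.getD_append _ _ _ _ h

theorem getD_right {U V : Weil1} (i : ℕ) :
    (tensor U V).shape.getD (U.shape.length + i) 0 = V.shape.getD i 0 := by
  simp [tensor, List.getElem?_append_right]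

theorem lt_length {U : Weil1} {i j : ℕ} (h : j < U.shape.getD i 0) : i < U.shape.length := by
  by_contra hi
  rw [List.getD_eq_default _ _ (not_lt.mp hi)] at h
  exact Nat.not_lt_zero _ h

/-- The first coproduct inclusion. -/
noncomputable def inl (U V : Weil1) : U ⟶ tensor U V :=
  mkHom _ _ (fun i j => gen _ i j) fun i j k => gen_mul_gen _ i j k

/-- The second coproduct inclusion. -/
noncomputable def inr (U V : Weil1) : V ⟶ tensor U V :=
  mkHom _ _ (fun i j => gen _ (U.shape.length + i) j) fun _ j k => gen_mul_gen _ _ j k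

/-- The universal property of the tensor product as a coproduct of commutative rigs. -/
noncomputable def descRing {U V : Weil1} {R : Type*} [CommSemiring R] (f : Alg U →+* R)
    (g : Alg V →+* R) : Alg (tensor U V) →+* R :=
  lift _ (fun i j => if i < U.shape.length then f (gen U i j)
    else g (gen V (i - U.shape.length) j)) fun i j k => by
      split_ifs
      · rw [← map_mul, gen_mul_gen, map_zero]
      · rw [← map_mul, gen_mul_gen, map_zero]

theorem descRing_comp_inl {U V : Weil1} {R : Type*} [CommSemiring R] (f : Alg U →+* R)
    (g : Alg V →+* R) : (descRing f g).comp (inl U V).toRingHom = f := by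
  apply ringHom_ext
  intro i j h
  have hi := lt_length h
  change descRing f g ((inl U V).val _) = _
  rw [inl, mkHom_gen h, descRing, lift_gen _ _ _ (by rwa [getD_left hi]), if_pos hi]

theorem descRing_comp_inr {U V : Weil1} {R : Type*} [CommSemiring R] (f : Alg U →+* R)
    (g : Alg V →+* R) : (descRing f g).comp (inr U V).toRingHom = g := by
  apply ringHom_ext
  intro i j h
  change descRing f g ((inr U V).val _) = _
  rw [inr, mkHom_gen h, descRing, lift_gen _ _ _ (by rwa [getD_right]), if_neg (by omega),
    Nat.add_sub_cancel_left]

theorem descRing_inl {U V : Weil1} {R : Type*} [CommSemiring R] (f : Alg U →+* R)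
    (g : Alg V →+* R) (a : Alg U) : descRing f g ((inl U V).val a) = f a :=
  RingHom.congr_fun (descRing_comp_inl f g) a

theorem descRing_inr {U V : Weil1} {R : Type*} [CommSemiring R] (f : Alg U →+* R)
    (g : Alg V →+* R) (a : Alg V) : descRing f g ((inr U V).val a) = g a :=
  RingHom.congr_fun (descRing_comp_inr f g) a

theorem tensor_ringHom_ext {U V : Weil1} {R : Type*} [CommSemiring R]
    {f g : Alg (tensor U V) →+* R} (h₁ : ∀ a, f ((inl U V).val a) = g ((inl U V).val a))
    (h₂ : ∀ a, f ((inr U V).val a) = g ((inr U V).val a)) : f = g := by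
  apply ringHom_ext
  intro i j h
  by_cases hi : i < U.shape.length
  · rw [getD_left hi] at h
    simpa [inl, mkHom_gen h] using h₁ (gen U i j)
  · obtain ⟨i, rfl⟩ := Nat.exists_eq_add_of_le (not_lt.mp hi)
    rw [getD_right] at h
    simpa [inr, mkHom_gen h] using h₂ (gen V i j)

/-- The universal property of the coproduct. -/
noncomputable def desc {U V X : Weil1} (f : U ⟶ X) (g : V ⟶ X) : tensor U V ⟶ X :=
  ⟨descRing f.toRingHom g.toRingHom⟩

@[simp]
theorem inl_desc {U V X : Weil1} (f : U ⟶ X) (g : V ⟶ X) : inl U V ≫ desc f g = f :=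
  Hom.ext (descRing_comp_inl _ _)

@[simp]
theorem inr_desc {U V X : Weil1} (f : U ⟶ X) (g : V ⟶ X) : inr U V ≫ desc f g = g :=
  Hom.ext (descRing_comp_inr _ _)

@[simp]
theorem inl_desc_assoc {U V X Y : Weil1} (f : U ⟶ X) (g : V ⟶ X) (h : X ⟶ Y) :
    inl U V ≫ desc f g ≫ h = f ≫ h := by rw [← Category.assoc, inl_desc]

@[simp]
theorem inr_desc_assoc {U V X Y : Weil1} (f : U ⟶ X) (g : V ⟶ X) (h : X ⟶ Y) :
    inr U V ≫ desc f g ≫ h = g ≫ h := by rw [← Category.assoc, inr_desc]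

theorem tensor_hom_ext {U V X : Weil1} {f g : tensor U V ⟶ X} (h₁ : inl U V ≫ f = inl U V ≫ g)
    (h₂ : inr U V ≫ f = inr U V ≫ g) : f = g :=
  Hom.ext (tensor_ringHom_ext (fun a => congrArg (fun k => Hom.val k a) h₁)
    fun a => congrArg (fun k => Hom.val k a) h₂)

theorem unit_hom_ext {X : Weil1} (f g : unit ⟶ X) : f = g :=
  hom_ext fun i j h => by simp [unit] at h

/-- The unique morphism `ℕ ⟶ X`. -/
noncomputable def ofUnit (X : Weil1) : unit ⟶ X := mkHom _ _ (fun _ _ => 0) (by simp)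

/-- The tensor product (that is, the coproduct) of morphisms. -/
noncomputable def tensorMap {U V U' V' : Weil1} (f : U ⟶ U') (g : V ⟶ V') :
    tensor U V ⟶ tensor U' V' := desc (f ≫ inl U' V') (g ≫ inr U' V')

/-- The tensor product is concatenation of shapes, so that it is strictly associative and unital. -/
noncomputable instance : MonoidalCategory Weil1 where
  tensorObj := tensor
  tensorUnit := unit
  tensorHom := tensorMap
  whiskerLeft U _ _ f := tensorMap (𝟙 U) f
  whiskerRight f U := tensorMap f (𝟙 U)
  associator U V X :=
    { hom := desc (desc (inl _ _) (inl _ _ ≫ inr _ _)) (inr _ _ ≫ inr _ _)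
      inv := desc (inl _ _ ≫ inl _ _) (desc (inr _ _ ≫ inl _ _) (inr _ _))
      hom_inv_id := by
        apply tensor_hom_ext
        · apply tensor_hom_ext <;> simp
        · simp
      inv_hom_id := by
        apply tensor_hom_ext
        · simp
        · apply tensor_hom_ext <;> simp }
  leftUnitor U :=
    { hom := desc (ofUnit U) (𝟙 U)
      inv := inr _ _
      hom_inv_id := tensor_hom_ext (unit_hom_ext _ _) (by simp)
      inv_hom_id := by simp }
  rightUnitor U :=
    { hom := desc (𝟙 U) (ofUnit U)
      inv := inl _ _
      hom_inv_id := tensor_hom_ext (by simp) (unit_hom_ext _ _)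
      inv_hom_id := by simp }
  tensorHom_def f g := by apply tensor_hom_ext <;> simp [tensorMap]
  id_tensorHom_id U V := by apply tensor_hom_ext <;> simp [tensorMap]
  tensorHom_comp_tensorHom f g h k := by apply tensor_hom_ext <;> simp [tensorMap]
  whiskerLeft_id U V := by apply tensor_hom_ext <;> simp [tensorMap]
  id_whiskerRight U V := by apply tensor_hom_ext <;> simp [tensorMap]
  associator_naturality f g h := by
    apply tensor_hom_ext
    · apply tensor_hom_ext <;> simp [tensorMap]
    · simp [tensorMap]
  leftUnitor_naturality f := tensor_hom_ext (unit_hom_ext _ _) (by simp [tensorMap])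
  rightUnitor_naturality f := tensor_hom_ext (by simp [tensorMap]) (unit_hom_ext _ _)
  pentagon U V X Y := by
    apply tensor_hom_ext
    · apply tensor_hom_ext
      · apply tensor_hom_ext <;> simp [tensorMap]
      · simp [tensorMap]
    · simp [tensorMap]
  triangle U V := by
    apply tensor_hom_ext
    · apply tensor_hom_ext
      · simp [tensorMap]
      · exact unit_hom_ext _ _
    · simp [tensorMap]

/-- The unique morphism `ℕ ⟶ X`. -/
noncomputable def fromUnit (X : Weil1) : 𝟙_ Weil1 ⟶ X := ofUnit X

theorem inl_whiskerLeft (U : Weil1) {V V' : Weil1} (f : V ⟶ V') : inl U V ≫ U ◁ f = inl U V' :=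
  (inl_desc _ _).trans (Category.id_comp _)

theorem inr_whiskerLeft (U : Weil1) {V V' : Weil1} (f : V ⟶ V') :
    inr U V ≫ U ◁ f = f ≫ inr U V' := inr_desc _ _

theorem inl_whiskerRight {U U' : Weil1} (f : U ⟶ U') (V : Weil1) :
    inl U V ≫ f ▷ V = f ≫ inl U' V := inl_desc _ _

theorem inr_whiskerRight {U U' : Weil1} (f : U ⟶ U') (V : Weil1) : inr U V ≫ f ▷ V = inr U' V :=
  (inr_desc _ _).trans (Category.id_comp _)

/-- The multiplication `V ⊗ V ⟶ V`. -/
noncomputable def fold (V : Weil1) : V ⊗ V ⟶ V := desc (𝟙 V) (𝟙 V)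

theorem inl_fold (V : Weil1) : inl V V ≫ fold V = 𝟙 V := inl_desc _ _

theorem inr_fold (V : Weil1) : inr V V ≫ fold V = 𝟙 V := inr_desc _ _

theorem inl_fold_assoc (V : Weil1) {Y : Weil1} (h : V ⟶ Y) : inl V V ≫ fold V ≫ h = h :=
  inl_desc_assoc _ _ _

theorem inr_fold_assoc (V : Weil1) {Y : Weil1} (h : V ⟶ Y) : inr V V ≫ fold V ≫ h = h :=
  inr_desc_assoc _ _ _

theorem fold_naturality {U V : Weil1} (k : U ⟶ V) :
    (k ⊗ₘ k) ≫ fold V = fold U ≫ k := by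
  apply tensor_hom_ext
  · change inl U U ≫ desc (k ≫ inl V V) _ ≫ _ = _
    rw [inl_desc_assoc, inl_fold_assoc, Category.assoc, inl_fold]
    simp
  · change inr U U ≫ desc _ (k ≫ inr V V) ≫ _ = _
    rw [inr_desc_assoc, inr_fold_assoc, Category.assoc, inr_fold]
    simp

theorem unit_fold (V : Weil1) :
    fromUnit V ▷ V ≫ fold V = (λ_ V).hom := by
  apply tensor_hom_ext
  · exact unit_hom_ext _ _
  · rw [← Category.assoc, inr_whiskerRight, inr_fold]
    exact (inr_desc _ _).symm

theorem fold_unit (V : Weil1) :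
    V ◁ fromUnit V ≫ fold V = (ρ_ V).hom := by
  apply tensor_hom_ext
  · rw [← Category.assoc, inl_whiskerLeft, inl_fold]
    exact (inl_desc _ _).symm
  · exact unit_hom_ext _ _

theorem fold_fold (V : Weil1) :
    fold V ▷ V ≫ fold V =
      (α_ V V V).hom ≫ V ◁ fold V ≫ fold V := by
  change tensorMap _ _ ≫ fold V = desc _ _ ≫ tensorMap _ _ ≫ fold V
  apply tensor_hom_ext
  · apply tensor_hom_ext <;> simp [tensorMap, inl_fold, inr_fold]
  · simp [tensorMap, inr_fold]

end Weil1

namespace Weil1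

/-! ### The generating morphisms -/

/-- `W_n = ℕ[x_0, …, x_{n-1}] / (x_j x_k)`. -/
def Wn (n : ℕ) : Weil1 := ⟨[n]⟩

/-- `W = ℕ[x] / x²`. -/
abbrev W : Weil1 := Wn 1

/-- The generator `x_j` of `W_n`. -/
noncomputable def x (n j : ℕ) : Alg (Wn n) := gen (Wn n) 0 j

/-- The morphism `W_n ⟶ V` with `x_j ↦ a j`. -/
noncomputable def ofWn (n : ℕ) {V : Weil1} (a : ℕ → Alg V) (ha : ∀ j k, a j * a k = 0) : Wn n ⟶ V :=
  mkHom _ _ (fun _ j => a j) fun _ j k => ha j k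

theorem ofWn_x {n : ℕ} {V : Weil1} {a : ℕ → Alg V} {ha : ∀ j k, a j * a k = 0} {j : ℕ}
    (h : j < n) : (ofWn n a ha).val (x n j) = a j :=
  mkHom_gen (by simpa [Wn] using h)

theorem x_mul_x (n j k : ℕ) : x n j * x n k = 0 := gen_mul_gen _ _ _ _

theorem Wn_hom_ext {n : ℕ} {V : Weil1} {f g : Wn n ⟶ V}
    (h : ∀ j, j < n → f.val (x n j) = g.val (x n j)) : f = g := by
  apply hom_ext
  intro i j hij
  obtain rfl : i = 0 := by
    have := lt_length hij
    simpa [Wn] using this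
  exact h j (by simpa [Wn] using hij)

/-- The augmentation `W_n ⟶ ℕ`; for `n = 1` this is the tangent projection. -/
noncomputable def aug (n : ℕ) : Wn n ⟶ 𝟙_ Weil1 := ofWn n (fun _ => 0) (by simp)

/-- The first projection `W_{n+m} ⟶ W_n`. -/
noncomputable def fstW (n m : ℕ) : Wn (n + m) ⟶ Wn n :=
  ofWn _ (fun j => x n j) fun j k => x_mul_x n j k

/-- The second projection `W_{n+m} ⟶ W_m`. -/
noncomputable def sndW (n m : ℕ) : Wn (n + m) ⟶ Wn m :=
  ofWn _ (fun j => if n ≤ j then x m (j - n) else 0) fun j k => by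
    split_ifs <;> simp [x_mul_x]

/-- The addition `W_2 ⟶ W`, `x_0, x_1 ↦ x`. -/
noncomputable def addW : Wn 2 ⟶ W := ofWn 2 (fun _ => x 1 0) fun _ _ => x_mul_x 1 0 0

/-- The outer variable of `W ⊗ W`. -/
noncomputable def xL : Alg (W ⊗ W) := (inl W W).val (x 1 0)

/-- The inner variable of `W ⊗ W`. -/
noncomputable def xR : Alg (W ⊗ W) := (inr W W).val (x 1 0)

theorem xL_mul_xL : xL * xL = 0 := by rw [xL, ← val_mul, x_mul_x, val_zero]
theorem xR_mul_xR : xR * xR = 0 := by rw [xR, ← val_mul, x_mul_x, val_zero]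

/-- The lift `W ⟶ W ⊗ W`, `x ↦ x_L x_R`. -/
noncomputable def liftW : W ⟶ W ⊗ W :=
  ofWn 1 (fun _ => xL * xR) fun _ _ => by
    rw [mul_mul_mul_comm, xL_mul_xL, zero_mul]

/-- The flip `W ⊗ W ⟶ W ⊗ W`. -/
noncomputable def flipW : W ⊗ W ⟶ W ⊗ W := desc (inr W W) (inl W W)

/-- The morphism `W_2 ⟶ W ⊗ W` with `x_0 ↦ x_R` and `x_1 ↦ x_L x_R`. -/
noncomputable def muW : Wn 2 ⟶ W ⊗ W :=
  ofWn 2 (fun j => if j = 0 then xR else xL * xR) fun j k => by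
    split_ifs
    · exact xR_mul_xR
    · rw [mul_left_comm, xR_mul_xR, mul_zero]
    · rw [mul_assoc, xR_mul_xR, mul_zero]
    · rw [mul_mul_mul_comm, xL_mul_xL, zero_mul]

/-- A functor preserves transverse limits if it preserves all tensor translates `U ⊗ - ⊗ V` of the
pullback squares `W_{n+m} = W_n ×_ℕ W_m` and `W_2 = (W ⊗ W) ×_W ℕ` (the third generating square,
that of identities, is preserved by every functor). -/
structure PreservesTransverse {D : Type*} [Category D] (F : Weil1 ⥤ D) : Prop where
  fibre_product (U V : Weil1) (n m : ℕ) :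
    IsPullback (F.map (U ◁ fstW n m ▷ V)) (F.map (U ◁ sndW n m ▷ V))
      (F.map (U ◁ aug n ▷ V)) (F.map (U ◁ aug m ▷ V))
  universality (U V : Weil1) :
    IsPullback (F.map (U ◁ muW ▷ V)) (F.map (U ◁ aug 2 ▷ V))
      (F.map (U ◁ (W ◁ aug 1 ≫ (ρ_ W).hom) ▷ V)) (F.map (U ◁ fromUnit W ▷ V))

/-! ### The transverse squares are pullbacks of rigs -/

/-- A commutative square of rigs that is a pullback on underlying sets. -/
structure IsRigPullback {P X Y Z : Weil1} (f : P ⟶ X) (g : P ⟶ Y) (h : X ⟶ Z) (k : Y ⟶ Z) :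
    Prop where
  w : f ≫ h = g ≫ k
  inj : ∀ a b, f.val a = f.val b → g.val a = g.val b → a = b
  surj : ∀ a b, h.val a = k.val b → ∃ c, f.val c = a ∧ g.val c = b

section Expansion

variable (U V : Weil1) (n : ℕ)

/-- The inclusion `U ⊗ V ⟶ U ⊗ W_n ⊗ V`. -/
noncomputable def incl : U ⊗ V ⟶ U ⊗ (Wn n ⊗ V) := U ◁ inr (Wn n) V

/-- The generators of the middle factor of `U ⊗ W_n ⊗ V`. -/
noncomputable def mid (j : ℕ) : Alg (U ⊗ (Wn n ⊗ V)) :=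
  (inr U (Wn n ⊗ V)).val ((inl (Wn n) V).val (x n j))

theorem mid_mul_mid (j k : ℕ) : mid U V n j * mid U V n k = 0 := by
  simp only [mid, ← val_mul, x_mul_x, val_zero]

/-- The element `b + ∑ b_j x_j`. -/
noncomputable def expand (b : Alg (U ⊗ V)) (c : Fin n → Alg (U ⊗ V)) : Alg (U ⊗ (Wn n ⊗ V)) :=
  (incl U V n).val b + ∑ j, (incl U V n).val (c j) * mid U V n j

/-- The map `(b, c) ↦ b + ∑ c_j x_j`, as a morphism of rigs. -/
noncomputable def expandHom :
    TrivSqZeroExt (Alg (U ⊗ V)) (Fin n → Alg (U ⊗ V)) →+* Alg (U ⊗ (Wn n ⊗ V)) where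
  toFun t := expand U V n t.fst t.snd
  map_zero' := by simp [expand]
  map_one' := by simp [expand]
  map_add' s t := by
    simp only [expand, TrivSqZeroExt.fst_add, TrivSqZeroExt.snd_add, Pi.add_apply, val_add,
      add_mul, Finset.sum_add_distrib]
    abel
  map_mul' s t := by
    have h : ∀ j k : Fin n, (incl U V n).val (s.snd j) * mid U V n j *
        ((incl U V n).val (t.snd k) * mid U V n k) = 0 := fun j k => by
      rw [mul_mul_mul_comm, mid_mul_mid, mul_zero]
    simp only [expand, TrivSqZeroExt.fst_mul, TrivSqZeroExt.snd_mul, Pi.add_apply, val_add,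
      add_mul, mul_add, Finset.sum_add_distrib, Pi.smul_apply, smul_eq_mul,
      MulOpposite.smul_eq_mul_unop, MulOpposite.unop_op, val_mul, h,
      Finset.sum_const_zero, add_zero, Finset.mul_sum, Finset.sum_mul, add_assoc]
    congr 1
    rw [add_comm]
    congr 1
    · exact Finset.sum_congr rfl fun j _ => by ring
    · exact Finset.sum_congr rfl fun j _ => by ring

/-- Reading off coefficients. -/
noncomputable def coeffs :
    Alg (U ⊗ (Wn n ⊗ V)) →+* TrivSqZeroExt (Alg (U ⊗ V)) (Fin n → Alg (U ⊗ V)) :=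
  descRing ((TrivSqZeroExt.inlHom _ _).comp (inl U V).toRingHom)
    (descRing
      (lift (Wn n) (R := TrivSqZeroExt (Alg (U ⊗ V)) (Fin n → Alg (U ⊗ V)))
        (fun _ j => if h : j < n then TrivSqZeroExt.inr (Pi.single (⟨j, h⟩ : Fin n) 1) else 0)
        fun i j k => by split_ifs <;> simp)
      ((TrivSqZeroExt.inlHom _ _).comp (inr U V).toRingHom))

theorem coeffs_incl (b : Alg (U ⊗ V)) : coeffs U V n ((incl U V n).val b) = TrivSqZeroExt.inl b := by
  suffices (coeffs U V n).comp (incl U V n).toRingHom = TrivSqZeroExt.inlHom _ _ from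
    RingHom.congr_fun this b
  apply tensor_ringHom_ext
  · intro a
    change coeffs U V n ((inl U V ≫ U ◁ inr (Wn n) V).val a) = _
    rw [inl_whiskerLeft]
    exact descRing_inl _ _ _
  · intro a
    change coeffs U V n ((inr U V ≫ U ◁ inr (Wn n) V).val a) = _
    rw [inr_whiskerLeft]
    exact (descRing_inr _ _ _).trans (descRing_inr _ _ _)

theorem coeffs_mid (j : Fin n) :
    coeffs U V n (mid U V n j) = TrivSqZeroExt.inr (Pi.single j 1) := by
  refine (descRing_inr _ _ _).trans ((descRing_inl _ _ _).trans ((lift_gen _ _ _ ?_).trans ?_))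
  · simp [Wn]
  · simp

theorem coeffs_expand (b : Alg (U ⊗ V)) (c : Fin n → Alg (U ⊗ V)) :
    coeffs U V n (expand U V n b c) = TrivSqZeroExt.inl b + TrivSqZeroExt.inr c := by
  simp only [expand, map_add, map_sum, map_mul, coeffs_incl, coeffs_mid,
    TrivSqZeroExt.inl_mul_inr]
  rw [← TrivSqZeroExt.inr_sum]
  congr 2
  ext k
  simp [Finset.sum_apply, Pi.single_apply]

theorem expand_injective {b b' : Alg (U ⊗ V)} {c c' : Fin n → Alg (U ⊗ V)}
    (h : expand U V n b c = expand U V n b' c') : b = b' ∧ c = c' := by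
  have := congrArg (coeffs U V n) h
  rw [coeffs_expand, coeffs_expand] at this
  exact ⟨by simpa using congrArg TrivSqZeroExt.fst this,
    by simpa using congrArg TrivSqZeroExt.snd this⟩

theorem exists_expand (a : Alg (U ⊗ (Wn n ⊗ V))) : ∃ b c, a = expand U V n b c := by
  suffices (expandHom U V n).comp (coeffs U V n) = RingHom.id _ from
    ⟨_, _, (RingHom.congr_fun this a).symm⟩
  apply tensor_ringHom_ext
  · intro a
    have h : (incl U V n).val ((inl U V).val a) = (inl U (Wn n ⊗ V)).val a := by
      change (inl U V ≫ U ◁ inr (Wn n) V).val a = _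
      rw [inl_whiskerLeft]
      rfl
    rw [← h]
    change expandHom U V n (coeffs U V n _) = (incl U V n).val _
    rw [coeffs_incl]
    simp [expandHom, expand]
  · intro a
    change ((expandHom U V n).comp (coeffs U V n)).comp (inr U (Wn n ⊗ V)).toRingHom a =
      (inr U (Wn n ⊗ V)).toRingHom a
    congr 1
    apply tensor_ringHom_ext
    · intro a
      change ((expandHom U V n).comp (coeffs U V n)).comp
        ((inr U (Wn n ⊗ V)).toRingHom.comp (inl (Wn n) V).toRingHom) a =
          ((inr U (Wn n ⊗ V)).toRingHom.comp (inl (Wn n) V).toRingHom) a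
      congr 1
      apply ringHom_ext
      intro i j hij
      obtain rfl : i = 0 := by
        have := lt_length hij
        simpa [Wn] using this
      have hj : j < n := by simpa [Wn] using hij
      change expandHom U V n (coeffs U V n (mid U V n (⟨j, hj⟩ : Fin n))) = mid U V n j
      rw [coeffs_mid]
      simp only [expandHom, expand, RingHom.coe_mk, MonoidHom.coe_mk, OneHom.coe_mk,
        TrivSqZeroExt.fst_inr, TrivSqZeroExt.snd_inr, val_zero, zero_add]
      rw [Finset.sum_eq_single (⟨j, hj⟩ : Fin n)]
      · rw [Pi.single_eq_same, val_one, one_mul]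
      · intro k _ hk
        rw [Pi.single_eq_of_ne hk, val_zero, zero_mul]
      · simp
    · intro a
      have h : (incl U V n).val ((inr U V).val a) = (inr U (Wn n ⊗ V)).val ((inr (Wn n) V).val a) := by
        change (inr U V ≫ U ◁ inr (Wn n) V).val a = _
        rw [inr_whiskerLeft]
        rfl
      change expandHom U V n (coeffs U V n ((inr U (Wn n ⊗ V)).val ((inr (Wn n) V).val a))) =
        (inr U (Wn n ⊗ V)).val ((inr (Wn n) V).val a)
      rw [← h, coeffs_incl]
      simp [expandHom, expand]

variable {U V n}

theorem whisker_incl {X : Weil1} (f : Wn n ⟶ X) (b : Alg (U ⊗ V)) :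
    (U ◁ f ▷ V).val ((incl U V n).val b) = (U ◁ inr X V).val b := by
  rw [← comp_val, incl, ← whiskerLeft_comp]
  exact congrArg (fun k => (U ◁ k).val b) (inr_whiskerRight f V)

theorem whisker_mid {X : Weil1} (f : Wn n ⟶ X) (j : ℕ) :
    (U ◁ f ▷ V).val (mid U V n j) = (inr U (X ⊗ V)).val ((inl X V).val (f.val (x n j))) := by
  have h₁ := congrArg (fun k => Hom.val k ((inl (Wn n) V).val (x n j))) (inr_whiskerLeft U (f ▷ V))
  have h₂ := congrArg (fun k => Hom.val k (x n j)) (inl_whiskerRight f V)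
  exact h₁.trans (congrArg (inr U (X ⊗ V)).val h₂)

theorem whisker_expand {X : Weil1} (f : Wn n ⟶ X) (b : Alg (U ⊗ V)) (c : Fin n → Alg (U ⊗ V)) :
    (U ◁ f ▷ V).val (expand U V n b c) = (U ◁ inr X V).val b + ∑ j, (U ◁ inr X V).val (c j) *
      (inr U (X ⊗ V)).val ((inl X V).val (f.val (x n j))) := by
  have h (s : Finset (Fin n)) (g : Fin n → Alg (U ⊗ (Wn n ⊗ V))) :
      (U ◁ f ▷ V).val (∑ j ∈ s, g j) = ∑ j ∈ s, (U ◁ f ▷ V).val (g j) :=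
    map_sum (U ◁ f ▷ V).toRingHom g s
  simp only [expand, val_add, h, val_mul, whisker_incl, whisker_mid]

theorem aug_expand (b : Alg (U ⊗ V)) (c : Fin n → Alg (U ⊗ V)) :
    (U ◁ aug n ▷ V).val (expand U V n b c) = (U ◁ (λ_ V).inv).val b := by
  rw [whisker_expand]
  have h : ∀ j : Fin n, (aug n).val (x n j) = 0 := fun j => ofWn_x j.2
  simp only [h, val_zero, mul_zero, Finset.sum_const_zero, add_zero]
  rfl

theorem unitor_injective {a b : Alg (U ⊗ V)}
    (h : (U ◁ (λ_ V).inv).val a = (U ◁ (λ_ V).inv).val b) : a = b := by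
  have := congrArg (U ◁ (λ_ V).hom).val h
  simpa only [← comp_val, ← whiskerLeft_comp, Iso.inv_hom_id, whiskerLeft_id, id_val] using this

theorem unitor_surjective (a : Alg (U ⊗ (𝟙_ Weil1 ⊗ V))) :
    ∃ b, a = (U ◁ (λ_ V).inv).val b := by
  refine ⟨(U ◁ (λ_ V).hom).val a, ?_⟩
  simp only [← comp_val, ← whiskerLeft_comp, Iso.hom_inv_id, whiskerLeft_id, id_val]

theorem fst_expand {m : ℕ} (b : Alg (U ⊗ V)) (c : Fin (n + m) → Alg (U ⊗ V)) :
    (U ◁ fstW n m ▷ V).val (expand U V (n + m) b c) =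
      expand U V n b fun j => c (Fin.castAdd m j) := by
  rw [whisker_expand, Fin.sum_univ_add]
  have h₁ : ∀ j : Fin n, (fstW n m).val (x (n + m) (Fin.castAdd m j : Fin (n + m))) = x n j :=
    fun j => ofWn_x (by omega)
  have h₂ : ∀ j : Fin m, (fstW n m).val (x (n + m) (Fin.natAdd n j : Fin (n + m))) = 0 := fun j =>
    (ofWn_x (by simp)).trans (gen_eq_zero (by simp [Wn]))
  simp only [h₁, h₂, val_zero, mul_zero, Finset.sum_const_zero, add_zero]
  rfl

theorem snd_expand {m : ℕ} (b : Alg (U ⊗ V)) (c : Fin (n + m) → Alg (U ⊗ V)) :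
    (U ◁ sndW n m ▷ V).val (expand U V (n + m) b c) =
      expand U V m b fun j => c (Fin.natAdd n j) := by
  rw [whisker_expand, Fin.sum_univ_add]
  have h₁ : ∀ j : Fin n, (sndW n m).val (x (n + m) (Fin.castAdd m j : Fin (n + m))) = 0 :=
    fun j => (ofWn_x (by simp; omega)).trans (if_neg (by simp))
  have h₂ : ∀ j : Fin m, (sndW n m).val (x (n + m) (Fin.natAdd n j : Fin (n + m))) = x m j :=
    fun j => (ofWn_x (by simp)).trans (by simp)
  simp only [h₁, h₂, val_zero, mul_zero, Finset.sum_const_zero, zero_add]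
  rfl

theorem fibre_product_isRigPullback (U V : Weil1) (n m : ℕ) :
    IsRigPullback (U ◁ fstW n m ▷ V) (U ◁ sndW n m ▷ V) (U ◁ aug n ▷ V) (U ◁ aug m ▷ V) where
  w := by
    apply Hom.ext
    ext a
    obtain ⟨b, c, rfl⟩ := exists_expand U V (n + m) a
    change (U ◁ aug n ▷ V).val ((U ◁ fstW n m ▷ V).val _) =
      (U ◁ aug m ▷ V).val ((U ◁ sndW n m ▷ V).val _)
    rw [fst_expand, snd_expand, aug_expand, aug_expand]
  inj a a' h₁ h₂ := by
    obtain ⟨b, c, rfl⟩ := exists_expand U V (n + m) a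
    obtain ⟨b', c', rfl⟩ := exists_expand U V (n + m) a'
    rw [fst_expand, fst_expand] at h₁
    rw [snd_expand, snd_expand] at h₂
    obtain ⟨rfl, e₁⟩ := expand_injective _ _ _ h₁
    obtain ⟨-, e₂⟩ := expand_injective _ _ _ h₂
    congr 1
    ext j
    induction j using Fin.addCases with
    | left j => exact congrFun e₁ j
    | right j => exact congrFun e₂ j
  surj a a' h := by
    obtain ⟨b, c, rfl⟩ := exists_expand U V n a
    obtain ⟨b', c', rfl⟩ := exists_expand U V m a'
    rw [aug_expand, aug_expand] at h
    obtain rfl := unitor_injective h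
    exact ⟨expand U V (n + m) b (Fin.addCases c c'), by simp [fst_expand], by simp [snd_expand]⟩

/-- `expand` for the outer variable of `U ⊗ W ⊗ W ⊗ V`, in terms of coefficients in
`U ⊗ W ⊗ V`. -/
noncomputable def expand₂ (b b' : Alg (U ⊗ (W ⊗ V))) : Alg (U ⊗ ((W ⊗ W) ⊗ V)) :=
  (U ◁ (α_ W W V).inv).val (expand U (W ⊗ V) 1 b fun _ => b')

theorem exists_expand₂ (a : Alg (U ⊗ ((W ⊗ W) ⊗ V))) : ∃ b b', a = expand₂ b b' := by
  obtain ⟨b, c, h⟩ := exists_expand U (W ⊗ V) 1 ((U ◁ (α_ W W V).hom).val a)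
  refine ⟨b, c 0, ?_⟩
  have hc : c = fun _ => c 0 := funext fun j => by rw [Subsingleton.elim j 0]
  rw [expand₂, ← hc, ← h, ← comp_val, ← whiskerLeft_comp, Iso.hom_inv_id, whiskerLeft_id, id_val]

theorem expand₂_injective {b b' c c' : Alg (U ⊗ (W ⊗ V))} (h : expand₂ b b' = expand₂ c c') :
    b = c ∧ b' = c' := by
  have h := congrArg (U ◁ (α_ W W V).hom).val h
  simp only [expand₂, ← comp_val] at h
  rw [← whiskerLeft_comp, Iso.inv_hom_id, whiskerLeft_id, id_val, id_val] at h
  obtain ⟨h₁, h₂⟩ := expand_injective _ _ _ h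
  exact ⟨h₁, congrFun h₂ 0⟩

theorem expand₂_eq (b b' : Alg (U ⊗ (W ⊗ V))) :
    expand₂ b b' = (U ◁ inr W W ▷ V).val b + (U ◁ inr W W ▷ V).val b' *
      (inr U ((W ⊗ W) ⊗ V)).val ((inl (W ⊗ W) V).val xL) := by
  have h₁ (c : Alg (U ⊗ (W ⊗ V))) :
      (U ◁ (α_ W W V).inv).val ((incl U (W ⊗ V) 1).val c) = (U ◁ inr W W ▷ V).val c := by
    rw [← comp_val, incl, ← whiskerLeft_comp]
    congr 2
    refine (inr_desc _ _).trans ?_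
    apply tensor_hom_ext
    · exact (inl_desc _ _).trans (inl_whiskerRight _ _).symm
    · exact (inr_desc _ _).trans (inr_whiskerRight _ _).symm
  have h₂ : (U ◁ (α_ W W V).inv).val (mid U (W ⊗ V) 1 0) =
      (inr U ((W ⊗ W) ⊗ V)).val ((inl (W ⊗ W) V).val xL) := by
    rw [mid, ← comp_val (inr U _), inr_whiskerLeft, comp_val, ← comp_val (inl _ _)]
    congr 1
    exact congrArg (fun k => Hom.val k (x 1 0)) (inl_desc (inl W W ≫ inl (W ⊗ W) V) _)
  simp [expand₂, expand, h₁, h₂]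

theorem mu_expand (b : Alg (U ⊗ V)) (c : Fin 2 → Alg (U ⊗ V)) :
    (U ◁ muW ▷ V).val (expand U V 2 b c) =
      expand₂ (expand U V 1 b fun _ => c 0) (expand U V 1 0 fun _ => c 1) := by
  have h₀ : muW.val (x 2 0) = xR := ofWn_x (by simp)
  have h₁ : muW.val (x 2 1) = xL * xR := ofWn_x (by simp)
  have h₂ : (inr W W).val (x 1 0) = xR := rfl
  rw [whisker_expand, expand₂_eq, whisker_expand (X := W ⊗ W), whisker_expand (X := W ⊗ W)]
  simp only [Fin.sum_univ_two, Fin.val_zero, Fin.val_one, Finset.univ_unique, Fin.default_eq_zero,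
    Finset.sum_singleton, Fin.isValue, h₀, h₁, h₂, val_mul, val_zero]
  ring

theorem proj_expand₂ (b b' : Alg (U ⊗ V)) (c c' : Fin 1 → Alg (U ⊗ V)) :
    (U ◁ (W ◁ aug 1 ≫ (ρ_ W).hom) ▷ V).val (expand₂ (expand U V 1 b c) (expand U V 1 b' c')) =
      expand U V 1 b fun _ => b' := by
  have h : inr W W ≫ W ◁ aug 1 ≫ (ρ_ W).hom = aug 1 ≫ fromUnit W := by
    rw [← Category.assoc, inr_whiskerLeft, Category.assoc]
    congr 1
    exact inr_desc _ _
  have h' : inl W W ≫ W ◁ aug 1 ≫ (ρ_ W).hom = 𝟙 W := by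
    rw [← Category.assoc, inl_whiskerLeft]
    exact inl_desc _ _
  have h₂ (a : Alg (U ⊗ (W ⊗ V))) : (U ◁ (W ◁ aug 1 ≫ (ρ_ W).hom) ▷ V).val
      ((U ◁ inr W W ▷ V).val a) = (U ◁ (fromUnit W) ▷ V).val ((U ◁ aug 1 ▷ V).val a) := by
    simp only [← comp_val, ← whiskerLeft_comp, ← comp_whiskerRight, h]
  have h₃ : (U ◁ (W ◁ aug 1 ≫ (ρ_ W).hom) ▷ V).val
      ((inr U ((W ⊗ W) ⊗ V)).val ((inl (W ⊗ W) V).val xL)) = mid U V 1 0 := by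
    have e₁ := congrArg (fun k => Hom.val k ((inl (W ⊗ W) V).val xL))
      (inr_whiskerLeft U ((W ◁ aug 1 ≫ (ρ_ W).hom) ▷ V))
    have e₂ := congrArg (fun k => Hom.val k xL) (inl_whiskerRight (W ◁ aug 1 ≫ (ρ_ W).hom) V)
    have e₃ := congrArg (fun k => Hom.val k (x 1 0)) h'
    exact e₁.trans (congrArg (inr U (W ⊗ V)).val (e₂.trans (congrArg (inl W V).val e₃)))
  have h₄ (a : Alg (U ⊗ V)) : (U ◁ fromUnit W ▷ V).val ((U ◁ (λ_ V).inv).val a) =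
      (incl U V 1).val a := by
    have h : (λ_ V).inv ≫ fromUnit W ▷ V = inr W V := inr_whiskerRight _ _
    rw [← comp_val, ← whiskerLeft_comp, h]
    rfl
  rw [expand₂_eq, val_add, val_mul, h₂, h₂, h₃, aug_expand, aug_expand, h₄, h₄, expand]
  simp

theorem zero_unitor (b : Alg (U ⊗ V)) :
    (U ◁ fromUnit W ▷ V).val ((U ◁ (λ_ V).inv).val b) = expand U V 1 b fun _ => 0 := by
  have h : (λ_ V).inv ≫ fromUnit W ▷ V = inr W V := inr_whiskerRight _ _
  rw [← comp_val, ← whiskerLeft_comp, h]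
  simp [expand, incl]

theorem universality_isRigPullback (U V : Weil1) :
    IsRigPullback (U ◁ muW ▷ V) (U ◁ aug 2 ▷ V) (U ◁ (W ◁ aug 1 ≫ (ρ_ W).hom) ▷ V)
      (U ◁ fromUnit W ▷ V) where
  w := by
    apply Hom.ext
    ext a
    obtain ⟨b, c, rfl⟩ := exists_expand U V 2 a
    change (U ◁ (W ◁ aug 1 ≫ (ρ_ W).hom) ▷ V).val ((U ◁ muW ▷ V).val _) =
      (U ◁ fromUnit W ▷ V).val ((U ◁ aug 2 ▷ V).val _)
    rw [mu_expand, proj_expand₂, aug_expand, zero_unitor]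
  inj a a' h₁ h₂ := by
    obtain ⟨b, c, rfl⟩ := exists_expand U V 2 a
    obtain ⟨b', c', rfl⟩ := exists_expand U V 2 a'
    rw [mu_expand, mu_expand] at h₁
    obtain ⟨h₁, h₃⟩ := expand₂_injective h₁
    obtain ⟨rfl, e₁⟩ := expand_injective _ _ _ h₁
    obtain ⟨-, e₂⟩ := expand_injective _ _ _ h₃
    congr 1
    ext j
    fin_cases j
    · exact congrFun e₁ 0
    · exact congrFun e₂ 0
  surj a a' h := by
    obtain ⟨b, b', rfl⟩ := exists_expand₂ a
    obtain ⟨b, c, rfl⟩ := exists_expand U V 1 b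
    obtain ⟨b', c', rfl⟩ := exists_expand U V 1 b'
    obtain ⟨d, rfl⟩ := unitor_surjective a'
    rw [proj_expand₂, zero_unitor] at h
    obtain ⟨rfl, e⟩ := expand_injective _ _ _ h
    obtain rfl : b' = 0 := congrFun e 0
    refine ⟨expand U V 2 b ![c 0, c' 0], ?_, aug_expand _ _⟩
    rw [mu_expand]
    congr 2 <;> ext j <;> rw [Subsingleton.elim j 0] <;> rfl

end Expansion

end Weil1

/-! ### Tangent categories and differential bundles -/

/-- A tangent structure on a category. -/
structure TangentStructure (C : Type u) [Category.{v} C] where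
  T : C ⥤ C
  p : T ⟶ 𝟭 C
  zero : 𝟭 C ⟶ T
  ℓ : T ⟶ T ⋙ T
  c : T ⋙ T ⟶ T ⋙ T
  /-- The fibre product `T ×_p T`, with its projections. -/
  T₂ : C ⥤ C
  π₀ : T₂ ⟶ T
  π₁ : T₂ ⟶ T
  add : T₂ ⟶ T
  isPullback_T₂ : ∀ M, IsPullback (π₀.app M) (π₁.app M) (p.app M) (p.app M)
  /-- Pullback powers of `p` exist and are preserved by `T`. -/
  pullback_powers : ∀ (M : C) (n : ℕ),
    ∃ s : Cone (WidePullbackShape.wideCospan M (fun _ : Fin n => T.obj M) fun _ => p.app M),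
      Nonempty (IsLimit s) ∧ Nonempty (IsLimit (T.mapCone s))
  isPullback_T_T₂ : ∀ M, IsPullback (T.map (π₀.app M)) (T.map (π₁.app M)) (T.map (p.app M))
    (T.map (p.app M))
  -- `(p, zero, add)` is a commutative monoid in the slice over each object
  zero_p : ∀ M, zero.app M ≫ p.app M = 𝟙 M
  add_p : ∀ M, add.app M ≫ p.app M = π₀.app M ≫ p.app M
  zero_add : ∀ M, (isPullback_T₂ M).lift (p.app M ≫ zero.app M) (𝟙 _)
    (by simp [zero_p]) ≫ add.app M = 𝟙 _
  add_comm : ∀ M, (isPullback_T₂ M).lift (π₁.app M) (π₀.app M) (isPullback_T₂ M).w.symm ≫ add.app M =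
    add.app M
  add_assoc : ∀ {X : C} (M : C) (x y z : X ⟶ T.obj M) (hxy : x ≫ p.app M = y ≫ p.app M)
    (hyz : y ≫ p.app M = z ≫ p.app M),
    (isPullback_T₂ M).lift ((isPullback_T₂ M).lift x y hxy ≫ add.app M) z
        (by simp [add_p, hxy, hyz]) ≫ add.app M =
      (isPullback_T₂ M).lift x ((isPullback_T₂ M).lift y z hyz ≫ add.app M)
        (by simp [add_p, hxy]) ≫ add.app M
  -- `c` is a symmetry, additive from `T p` to `p T`
  c_c : ∀ M, c.app M ≫ c.app M = 𝟙 _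
  yang_baxter : ∀ M, c.app (T.obj M) ≫ T.map (c.app M) ≫ c.app (T.obj M) =
    T.map (c.app M) ≫ c.app (T.obj M) ≫ T.map (c.app M)
  c_p : ∀ M, c.app M ≫ p.app (T.obj M) = T.map (p.app M)
  zero_c : ∀ M, T.map (zero.app M) ≫ c.app M = zero.app (T.obj M)
  add_c : ∀ M, T.map (add.app M) ≫ c.app M =
    (isPullback_T₂ (T.obj M)).lift (T.map (π₀.app M) ≫ c.app M) (T.map (π₁.app M) ≫ c.app M)
      (by simp only [Category.assoc, c_p, ← T.map_comp, (isPullback_T₂ M).w]) ≫ add.app (T.obj M)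
  -- `ℓ` is additive from `p` to `T p`, over `zero`
  ℓ_p : ∀ M, ℓ.app M ≫ T.map (p.app M) = p.app M ≫ zero.app M
  zero_ℓ : ∀ M, zero.app M ≫ ℓ.app M = zero.app M ≫ T.map (zero.app M)
  add_ℓ : ∀ M, add.app M ≫ ℓ.app M =
    (isPullback_T_T₂ M).lift (π₀.app M ≫ ℓ.app M) (π₁.app M ≫ ℓ.app M)
      (by simp only [Category.assoc, ℓ_p]; rw [← Category.assoc, (isPullback_T₂ M).w, Category.assoc])
      ≫ T.map (add.app M)
  ℓ_ℓ : ∀ M, ℓ.app M ≫ T.map (ℓ.app M) = ℓ.app M ≫ ℓ.app (T.obj M)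
  ℓ_c : ∀ M, ℓ.app M ≫ c.app M = ℓ.app M
  c_ℓ : ∀ M, c.app M ≫ ℓ.app (T.obj M) = T.map (ℓ.app M) ≫ c.app (T.obj M) ≫ T.map (c.app M)
  /-- Universality of the lift: `(x, y) ↦ T add (zero x, ℓ y)` is a pullback of `zero` along `T p`. -/
  universality : ∀ M, IsPullback
    ((isPullback_T_T₂ M).lift (π₀.app M ≫ zero.app (T.obj M)) (π₁.app M ≫ ℓ.app M)
      (by
        have h := zero.naturality (p.app M)
        simp only [Functor.id_obj, Functor.id_map] at h
        rw [Category.assoc, Category.assoc, ℓ_p, ← h, ← Category.assoc, ← Category.assoc,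
          (isPullback_T₂ M).w]) ≫ T.map (add.app M))
    (π₀.app M ≫ p.app M) (T.map (p.app M)) (zero.app M)

namespace TangentStructure

variable {C : Type u} [Category.{v} C] (𝕋 : TangentStructure C)

/-- The iterates of the tangent functor. -/
def iter : ℕ → C ⥤ C
  | 0 => 𝟭 C
  | n + 1 => iter n ⋙ 𝕋.T

/-- A `T`-limit: a limit cone that is preserved by all iterates of `T`. -/
def IsTLimit {J : Type*} [Category J] {K : J ⥤ C} (s : Cone K) : Prop :=
  ∀ n, Nonempty (IsLimit ((𝕋.iter n).mapCone s))

/-- `i` is a `T`-equalizer of `f` and `g`. -/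
def IsTEqualizer {E X Y : C} (i : E ⟶ X) (f g : X ⟶ Y) : Prop :=
  ∃ w : i ≫ f = i ≫ g, 𝕋.IsTLimit (Fork.ofι i w)

/-- Every parallel pair has a `T`-equalizer. -/
def HasTEqualizers : Prop :=
  ∀ ⦃X Y : C⦄ (f g : X ⟶ Y), ∃ (E : C) (i : E ⟶ X), 𝕋.IsTEqualizer i f g

/-- Every cospan has a `T`-pullback. -/
def HasTPullbacks : Prop :=
  ∀ ⦃X Y Z : C⦄ (f : X ⟶ Z) (g : Y ⟶ Z), ∃ s : PullbackCone f g, 𝕋.IsTLimit s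

end TangentStructure

section Bundles

variable {C : Type u} [Category.{v} C] (𝕋 : TangentStructure C)

/-- The data of a pre-differential bundle `(q : E ⟶ M, ξ, lam)`. -/
structure PreBundleData where
  E : C
  M : C
  q : E ⟶ M
  ξ : M ⟶ E
  lam : E ⟶ 𝕋.T.obj E

/-- A pre-differential bundle: a lift `lam` with a splitting `(q, ξ)` of the idempotent
`p ∘ lam`. -/
structure PreDiffBundle extends PreBundleData 𝕋 where
  lam_lam : lam ≫ 𝕋.T.map lam = lam ≫ 𝕋.ℓ.app E
  ξ_q : ξ ≫ q = 𝟙 M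
  q_ξ : q ≫ ξ = lam ≫ 𝕋.p.app E

namespace PreDiffBundle

variable {𝕋}

/-- A morphism of pre-differential bundles is a morphism of the underlying lifts. -/
@[ext]
structure Hom (P Q : PreDiffBundle 𝕋) where
  f : P.E ⟶ Q.E
  comm : f ≫ Q.lam = P.lam ≫ 𝕋.T.map f

@[simps]
instance : Category (PreDiffBundle 𝕋) where
  Hom := Hom
  id P := ⟨𝟙 _, by simp⟩
  comp f g := ⟨f.f ≫ g.f, by rw [Category.assoc, g.comm, ← Category.assoc, f.comm, Category.assoc, 𝕋.T.map_comp]⟩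

/-- The total space functor. -/
@[simps]
def total : PreDiffBundle 𝕋 ⥤ C where
  obj P := P.E
  map f := f.f

/-- The lift of `P` is non-singular: it is a `T`-equalizer of the idempotent `e.E = p ∘ ℓ` of the
free lift on `E` and of `T e = T (p ∘ lam)`. -/
def IsNonsingular (P : PreDiffBundle 𝕋) : Prop :=
  𝕋.IsTEqualizer P.lam (𝕋.ℓ.app P.E ≫ 𝕋.p.app (𝕋.T.obj P.E))
    (𝕋.T.map (P.lam ≫ 𝕋.p.app P.E))

/-- A differential bundle: the lift is non-singular and the `T`-pullback powers of `q` exist. -/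
def IsDiffBundle (𝕋 : TangentStructure C) : ObjectProperty (PreDiffBundle 𝕋) := fun P =>
  P.IsNonsingular ∧ ∀ n : ℕ,
    ∃ s : Cone (WidePullbackShape.wideCospan P.M (fun _ : Fin n => P.E) fun _ => P.q),
      𝕋.IsTLimit s

end PreDiffBundle

/-- The category of differential bundles, a full subcategory of pre-differential bundles. -/
abbrev DiffBundle := (PreDiffBundle.IsDiffBundle 𝕋).FullSubcategory

/-- The inclusion of differential bundles into pre-differential bundles. -/
abbrev DiffBundle.incl : DiffBundle 𝕋 ⥤ PreDiffBundle 𝕋 := (PreDiffBundle.IsDiffBundle 𝕋).ι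

end Bundles

/-! ### Weil spaces -/

/-- Functors to types preserve transverse limits if they do so elementwise. -/
theorem Weil1.PreservesTransverse.of_types {F : Weil1 ⥤ Type v}
    (h : ∀ {P X Y Z : Weil1} {f : P ⟶ X} {g : P ⟶ Y} {h : X ⟶ Z} {k : Y ⟶ Z},
      Weil1.IsRigPullback f g h k → IsPullback (F.map f) (F.map g) (F.map h) (F.map k)) :
    Weil1.PreservesTransverse F where
  fibre_product U V n m := h (Weil1.fibre_product_isRigPullback U V n m)
  universality U V := h (Weil1.universality_isRigPullback U V)

namespace WeilSpaces

/-- A Weil space is a functor `Weil1 ⥤ Type` that preserves transverse limits. -/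
def IsWeilSpace : ObjectProperty (Weil1 ⥤ Type v) := fun X => Weil1.PreservesTransverse X

theorem isPullback_tensor {X Y : Weil1 ⥤ Type v} {P A B Z : Weil1} {f : P ⟶ A} {g : P ⟶ B}
    {h : A ⟶ Z} {k : B ⟶ Z} (hX : IsPullback (X.map f) (X.map g) (X.map h) (X.map k))
    (hY : IsPullback (Y.map f) (Y.map g) (Y.map h) (Y.map k)) :
    IsPullback ((X ⊗ Y).map f) ((X ⊗ Y).map g) ((X ⊗ Y).map h) ((X ⊗ Y).map k) := by
  rw [Types.isPullback_iff] at hX hY ⊢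
  obtain ⟨wX, iX, sX⟩ := hX
  obtain ⟨wY, iY, sY⟩ := hY
  refine ⟨?_, ?_, ?_⟩
  · ext ⟨a, b⟩
    have h₁ : X.map h (X.map f a) = X.map k (X.map g a) := ConcreteCategory.congr_hom wX a
    have h₂ : Y.map h (Y.map f b) = Y.map k (Y.map g b) := ConcreteCategory.congr_hom wY b
    exact Prod.ext h₁ h₂
  · rintro ⟨a, b⟩ ⟨a', b'⟩ ⟨h₁, h₂⟩
    exact Prod.ext (iX a a' ⟨congrArg Prod.fst h₁, congrArg Prod.fst h₂⟩)
      (iY b b' ⟨congrArg Prod.snd h₁, congrArg Prod.snd h₂⟩)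
  · rintro ⟨a, b⟩ ⟨a', b'⟩ e
    obtain ⟨c, h₁, h₂⟩ := sX a a' (congrArg Prod.fst e)
    obtain ⟨d, h₃, h₄⟩ := sY b b' (congrArg Prod.snd e)
    exact ⟨⟨c, d⟩, Prod.ext h₁ h₃, Prod.ext h₂ h₄⟩

theorem isPullback_unit {P A B Z : Weil1} (f : P ⟶ A) (g : P ⟶ B)
    (h : A ⟶ Z) (k : B ⟶ Z) : IsPullback ((𝟙_ (Weil1 ⥤ Type v)).map f)
      ((𝟙_ (Weil1 ⥤ Type v)).map g) ((𝟙_ (Weil1 ⥤ Type v)).map h)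
      ((𝟙_ (Weil1 ⥤ Type v)).map k) :=
  IsPullback.of_id_fst

instance : IsWeilSpace.{v}.IsMonoidal where
  prop_unit :=
    { fibre_product _ _ _ _ := isPullback_unit _ _ _ _
      universality _ _ := isPullback_unit _ _ _ _ }
  prop_tensor _ _ hX hY :=
    { fibre_product U V n m := isPullback_tensor (hX.fibre_product U V n m)
        (hY.fibre_product U V n m)
      universality U V := isPullback_tensor (hX.universality U V) (hY.universality U V) }

end WeilSpaces

/-- The cartesian category of Weil spaces. -/
abbrev WeilSpace : Type (v + 1) := WeilSpaces.IsWeilSpace.{v}.FullSubcategory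

namespace WeilSpace

/-- The value of a morphism of Weil spaces at an element. -/
def val {X Y : WeilSpace.{v}} (f : X ⟶ Y) (V : Weil1) (a : X.obj.obj V) : Y.obj.obj V :=
  f.hom.app V a

theorem hom_ext {X Y : WeilSpace.{v}} {f g : X ⟶ Y} (h : ∀ V a, val f V a = val g V a) : f = g :=
  ObjectProperty.hom_ext _ (NatTrans.ext (funext fun V => by ext a; exact h V a))

theorem val_naturality {X Y : WeilSpace.{v}} (f : X ⟶ Y) {U V : Weil1} (k : U ⟶ V)
    (a : X.obj.obj U) : val f V (X.obj.map k a) = Y.obj.map k (val f U a) :=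
  ConcreteCategory.congr_hom (f.hom.naturality k) a

/-- Construct a morphism of Weil spaces. -/
noncomputable def ofFun {X Y : WeilSpace.{v}} (f : ∀ V, X.obj.obj V → Y.obj.obj V)
    (hf : ∀ {U V : Weil1} (k : U ⟶ V) (a : X.obj.obj U), f V (X.obj.map k a) = Y.obj.map k (f U a)) :
    X ⟶ Y :=
  ObjectProperty.homMk
    { app V := ↾(f V)
      naturality U V k := by ext a; exact hf k a }

theorem val_congr {X Y : WeilSpace.{v}} {f g : X ⟶ Y} (h : f = g) (V : Weil1) (a : X.obj.obj V) :
    val f V a = val g V a := by rw [h]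

theorem val_comp {X Y Z : WeilSpace.{v}} (f : X ⟶ Y) (g : Y ⟶ Z) (V : Weil1) (a : X.obj.obj V) :
    val (f ≫ g) V a = val g V (val f V a) := rfl

end WeilSpace


open MonoidalLeftAction

/-- An action of `Weil1` on `C` presents a tangent category if the functors `V ↦ V ⊙ A` preserve
transverse limits. -/
class IsTangentAction (C : Type u) [Category.{v} C] [MonoidalLeftAction Weil1 C] : Prop where
  preserves : ∀ A : C, Weil1.PreservesTransverse (actionRight Weil1 A)

namespace WeilEnrichment

section

variable {C : Type u} [Category.{v} C]

theorem isPullback_hom {P X Y Z : C} {f : P ⟶ X} {g : P ⟶ Y} {h : X ⟶ Z} {k : Y ⟶ Z}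
    (H : IsPullback f g h k) (A : C) :
    IsPullback (↾fun a : A ⟶ P => a ≫ f : (A ⟶ P) ⟶ (A ⟶ X)) (↾fun a : A ⟶ P => a ≫ g)
      (↾fun a : A ⟶ X => a ≫ h : (A ⟶ X) ⟶ (A ⟶ Z)) (↾fun a : A ⟶ Y => a ≫ k) := by
  rw [Types.isPullback_iff]
  refine ⟨?_, ?_, ?_⟩
  · ext a
    have e : (a ≫ f) ≫ h = (a ≫ g) ≫ k := by rw [Category.assoc, H.w, Category.assoc]
    exact e
  · rintro a b ⟨h₁, h₂⟩
    exact H.hom_ext h₁ h₂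
  · intro a b e
    exact ⟨H.lift a b e, H.lift_fst _ _ _, H.lift_snd _ _ _⟩

end

variable {C : Type u} [Category.{v} C] [MonoidalLeftAction Weil1 C]

/-- The functor `V ↦ C(A, V ⊙ B)`. -/
noncomputable def homFunctor (A B : C) : Weil1 ⥤ Type v where
  obj V := A ⟶ V ⊙ₗ B
  map k := ↾fun f => f ≫ k ⊵ₗ B

/-- The Weil space of morphisms, `V ↦ C(A, V ⊙ B)`. -/
noncomputable def hom [IsTangentAction C] (A B : C) : WeilSpace.{v} :=
  ⟨homFunctor A B,
    { fibre_product U V n m :=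
        isPullback_hom ((IsTangentAction.preserves B).fibre_product U V n m) A
      universality U V := isPullback_hom ((IsTangentAction.preserves B).universality U V) A }⟩

/-- The unit `A ≅ ℕ ⊙ A ⟶ V ⊙ A`. -/
noncomputable def idFun (V : Weil1) (A : C) : A ⟶ V ⊙ₗ A := (λₗ A).inv ≫ Weil1.fromUnit V ⊵ₗ A

/-- The composite of `f : A ⟶ V ⊙ B` and `g : B ⟶ V ⊙ D` is `f ≫ (V ⊙ g)` followed by the
multiplication `V ⊗ V ⟶ V`. -/
noncomputable def compFun {A B D : C} {V : Weil1} (f : A ⟶ V ⊙ₗ B) (g : B ⟶ V ⊙ₗ D) : A ⟶ V ⊙ₗ D :=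
  f ≫ V ⊴ₗ g ≫ (αₗ V V D).inv ≫ Weil1.fold V ⊵ₗ D

theorem idFun_naturality {U V : Weil1} (k : U ⟶ V) (A : C) :
    idFun V A = idFun U A ≫ k ⊵ₗ A := by
  rw [idFun, idFun, Category.assoc, ← comp_actionHomLeft,
    Weil1.unit_hom_ext (_ ≫ k) (Weil1.fromUnit _)]

theorem compFun_naturality {A B D : C} {U V : Weil1} (k : U ⟶ V) (f : A ⟶ U ⊙ₗ B)
    (g : B ⟶ U ⊙ₗ D) : compFun (f ≫ k ⊵ₗ B) (g ≫ k ⊵ₗ D) = compFun f g ≫ k ⊵ₗ D := by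
  have h := actionAssocIso_inv_naturality k k (𝟙 D)
  rw [actionHom_id, actionHom_id, actionHom_def] at h
  simp only [compFun, Category.assoc, actionHomRight_comp]
  rw [← comp_actionHomLeft, ← Weil1.fold_naturality, comp_actionHomLeft, ← reassoc_of% h,
    ← action_exchange_assoc]

theorem idFun_compFun {A B : C} {V : Weil1} (f : A ⟶ V ⊙ₗ B) : compFun (idFun V A) f = f := by
  rw [compFun, idFun, Category.assoc, ← action_exchange_assoc, actionUnitIso_inv_naturality_assoc,
    actionHomLeft_action]
  simp only [Category.assoc, Iso.hom_inv_id_assoc, ← comp_actionHomLeft, Weil1.unit_fold]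
  simp

theorem compFun_idFun {A B : C} {V : Weil1} (f : A ⟶ V ⊙ₗ B) : compFun f (idFun V B) = f := by
  have h : V ⊴ₗ Weil1.fromUnit V ⊵ₗ B ≫ (αₗ V V B).inv =
      (αₗ V _ B).inv ≫ (V ◁ Weil1.fromUnit V) ⊵ₗ B := by simp
  rw [compFun, idFun, actionHomRight_comp, Category.assoc, reassoc_of% h, ← comp_actionHomLeft,
    Weil1.fold_unit]
  simp

theorem compFun_assoc {A B D E : C} {V : Weil1} (f : A ⟶ V ⊙ₗ B) (g : B ⟶ V ⊙ₗ D)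
    (h : D ⟶ V ⊙ₗ E) : compFun (compFun f g) h = compFun f (compFun g h) := by
  have e₁ : V ⊴ₗ Weil1.fold V ⊵ₗ E ≫ (αₗ V V E).inv =
      (αₗ V (V ⊗ V) E).inv ≫ (V ◁ Weil1.fold V) ⊵ₗ E := by simp
  have e₂ : (αₗ V V (V ⊙ₗ E)).inv ≫ (αₗ (V ⊗ V) V E).inv ≫ (α_ V V V).hom ⊵ₗ E =
      V ⊴ₗ (αₗ V V E).inv ≫ (αₗ V (V ⊗ V) E).inv := by
    have h := associator_actionHom V V V E
    have : V ⊴ₗ (αₗ V V E).inv ≫ (αₗ V (V ⊗ V) E).inv =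
      inv ((αₗ V (V ⊗ V) E).hom ≫ V ⊴ₗ (αₗ V V E).hom) := by
      apply IsIso.eq_inv_of_hom_inv_id
      simp
    rw [this]
    apply IsIso.eq_inv_of_hom_inv_id
    have h' := congrArg (fun k => (α_ V V V).inv ⊵ₗ E ≫ k) h
    simp only [inv_hom_actionHomLeft_assoc] at h'
    rw [h']
    simp
  simp only [compFun, Category.assoc, actionHomRight_comp]
  rw [← action_exchange_assoc, actionHomLeft_action, tensor_actionHomRight]
  simp only [Category.assoc, Iso.inv_hom_id_assoc, Iso.hom_inv_id_assoc, ← comp_actionHomLeft,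
    Weil1.fold_fold]
  rw [comp_actionHomLeft, reassoc_of% e₂, reassoc_of% e₁, comp_actionHomLeft]

theorem compFun_inl_inr {A B D : C} {U V : Weil1} (f : A ⟶ U ⊙ₗ B) (g : B ⟶ V ⊙ₗ D) :
    compFun (V := U ⊗ V) (f ≫ Weil1.inl U V ⊵ₗ B) (g ≫ Weil1.inr U V ⊵ₗ D) =
      f ≫ U ⊴ₗ g ≫ (αₗ U V D).inv := by
  let i : U ⟶ U ⊗ V := Weil1.inl U V
  let j : V ⟶ U ⊗ V := Weil1.inr U V
  change compFun (V := U ⊗ V) (f ≫ i ⊵ₗ B) (g ≫ j ⊵ₗ D) = _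
  have h := actionAssocIso_inv_naturality i j (𝟙 D)
  rw [actionHom_id, actionHom_id, actionHom_def] at h
  have e : (i ⊗ₘ j) ≫ Weil1.fold (U ⊗ V) = 𝟙 _ := by
    apply Weil1.tensor_hom_ext
    · change Weil1.inl U V ≫ Weil1.desc (i ≫ Weil1.inl _ _) _ ≫ _ = _
      rw [Weil1.inl_desc_assoc, Category.assoc, Weil1.inl_fold]
    · change Weil1.inr U V ≫ Weil1.desc _ (j ≫ Weil1.inr _ _) ≫ _ = _
      rw [Weil1.inr_desc_assoc, Category.assoc, Weil1.inr_fold]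
  rw [compFun, Category.assoc, ← action_exchange_assoc, actionHomRight_comp, Category.assoc,
    action_exchange_assoc]
  rw [Category.assoc] at h
  rw [reassoc_of% h, ← comp_actionHomLeft, e]
  simp

theorem compFun_comp_idFun {A B D : C} {V : Weil1} (g : A ⟶ V ⊙ₗ B) (f : B ⟶ D) :
    compFun g (f ≫ idFun V D) = g ≫ V ⊴ₗ f := by
  have h := compFun_idFun (g ≫ V ⊴ₗ f)
  rw [compFun, Category.assoc] at h
  rw [compFun, actionHomRight_comp, Category.assoc, h]

theorem comp_idFun_compFun {A B D : C} {V : Weil1} (f : A ⟶ B) (g : B ⟶ V ⊙ₗ D) :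
    compFun (f ≫ idFun V B) g = f ≫ g := by
  have h := idFun_compFun g
  rw [compFun] at h
  rw [compFun, Category.assoc, h]

theorem idFun_unit (A : C) : idFun (𝟙_ Weil1) A ≫ (λₗ A).hom = 𝟙 A := by
  have h : Weil1.fromUnit (𝟙_ Weil1) = 𝟙 _ := Weil1.unit_hom_ext _ _
  rw [idFun, h]
  simp

theorem compFun_unit {A B D : C} (f : A ⟶ 𝟙_ Weil1 ⊙ₗ B) (g : B ⟶ 𝟙_ Weil1 ⊙ₗ D) :
    compFun f g ≫ (λₗ D).hom = (f ≫ (λₗ B).hom) ≫ g ≫ (λₗ D).hom := by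
  have h : Weil1.fold (𝟙_ Weil1) = (λ_ (𝟙_ Weil1)).hom :=
    Weil1.tensor_hom_ext (Weil1.unit_hom_ext _ _) (Weil1.unit_hom_ext _ _)
  rw [compFun, h]
  simp

variable [IsTangentAction C]

/-- The identity of the enrichment. -/
noncomputable def id (A : C) : 𝟙_ WeilSpace.{v} ⟶ hom A A :=
  WeilSpace.ofFun (fun V _ => idFun V A) fun k _ => idFun_naturality k A

/-- The composition of the enrichment. -/
noncomputable def comp (A B D : C) : hom A B ⊗ hom B D ⟶ hom A D :=
  WeilSpace.ofFun (fun _ a => compFun a.1 a.2) fun k a => compFun_naturality k a.1 a.2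

/-- The enrichment of a tangent category in Weil spaces. -/
noncomputable instance : EnrichedCategory WeilSpace.{v} C where
  Hom := hom
  id := id
  comp := comp
  id_comp A B := WeilSpace.hom_ext fun V f => idFun_compFun (V := V) (A := A) (B := B) f
  comp_id A B := WeilSpace.hom_ext fun V f => compFun_idFun (V := V) (A := A) (B := B) f
  assoc A B D E := WeilSpace.hom_ext fun V a =>
    compFun_assoc (V := V) (A := A) (B := B) (D := D) (E := E) a.1 a.2.1 a.2.2

end WeilEnrichment

/-! ### The enriched category `Λ⁺` -/

/-- The objects of `Λ⁺`. -/
inductive LambdaPlus : Type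
  | base
  | total

namespace LambdaPlus

open Weil1

/-- The values of `D + 1`, where `D` is the Weil space represented by `W`. -/
abbrev Endo (V : Weil1) : Type v := ULift.{v} (W ⟶ V) ⊕ PUnit.{v + 1}

/-- The functor `D + 1`. -/
noncomputable def endoFunctor : Weil1 ⥤ Type v where
  obj V := Endo V
  map k := ↾Sum.map (fun f => ⟨f.down ≫ k⟩) fun _ => PUnit.unit
  map_id V := by
    ext (f | f)
    · exact congrArg (fun g => Sum.inl (ULift.up g)) (Category.comp_id f.down)
    · rfl
  map_comp k l := by
    ext (f | f)
    · exact congrArg (fun g => Sum.inl (ULift.up g)) (Category.assoc f.down k l).symm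
    · rfl

theorem W_hom_ext {U : Weil1} {a b : W ⟶ U} (e : a.val (x 1 0) = b.val (x 1 0)) : a = b :=
  Wn_hom_ext fun j hj => by
    obtain rfl : j = 0 := by omega
    exact e

theorem isPullback_endo {P X Y Z : Weil1} {f : P ⟶ X} {g : P ⟶ Y} {h : X ⟶ Z} {k : Y ⟶ Z}
    (H : IsRigPullback f g h k) :
    IsPullback (endoFunctor.{v}.map f) (endoFunctor.{v}.map g) (endoFunctor.{v}.map h)
      (endoFunctor.{v}.map k) := by
  rw [Types.isPullback_iff]
  refine ⟨?_, ?_, ?_⟩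
  · rw [← endoFunctor.map_comp, ← endoFunctor.map_comp, H.w]
  · rintro (a | a) (b | b) ⟨h₁, h₂⟩
    · have e₁ : a.down ≫ f = b.down ≫ f := congrArg ULift.down (Sum.inl_injective h₁)
      have e₂ : a.down ≫ g = b.down ≫ g := congrArg ULift.down (Sum.inl_injective h₂)
      obtain rfl : a = b := ULift.down_injective <| W_hom_ext (H.inj _ _ (congrArg (fun t => Hom.val t (x 1 0)) e₁)
        (congrArg (fun t => Hom.val t (x 1 0)) e₂))
      rfl
    · cases h₁
    · cases h₁
    · rfl
  · rintro (a | a) (b | b) e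
    · have e' : a.down ≫ h = b.down ≫ k := congrArg ULift.down (Sum.inl_injective e)
      obtain ⟨c, hc₁, hc₂⟩ := H.surj (a.down.val (x 1 0)) (b.down.val (x 1 0))
        (congrArg (fun t => Hom.val t (x 1 0)) e')
      have hc : c * c = 0 := by
        apply H.inj
        · rw [val_mul, hc₁, ← val_mul, x_mul_x, val_zero, val_zero]
        · rw [val_mul, hc₂, ← val_mul, x_mul_x, val_zero, val_zero]
      have hx : (ofWn 1 (fun _ => c) fun _ _ => hc).val (x 1 0) = c := ofWn_x (by simp)
      refine ⟨Sum.inl ⟨ofWn 1 (fun _ => c) fun _ _ => hc⟩, ?_, ?_⟩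
      · refine congrArg (fun t => Sum.inl (ULift.up t)) (W_hom_ext ?_)
        rw [comp_val, hx, hc₁]
      · refine congrArg (fun t => Sum.inl (ULift.up t)) (W_hom_ext ?_)
        rw [comp_val, hx, hc₂]
    · cases e
    · cases e
    · exact ⟨Sum.inr PUnit.unit, rfl, rfl⟩

/-- The Weil space `D + 1`. -/
noncomputable def endo : WeilSpace.{v} :=
  ⟨endoFunctor, Weil1.PreservesTransverse.of_types isPullback_endo⟩

theorem liftW_val : liftW.val (x 1 0) = xL * xR := ofWn_x (by simp)

theorem aug_val : (aug 1).val (x 1 0) = 0 := ofWn_x (by simp)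

/-- The multiplication of `D`, which takes the square-zero elements `a` and `b` to `a b`. -/
noncomputable def mulD {V : Weil1} (f g : W ⟶ V) : W ⟶ V := liftW ≫ desc f g

theorem mulD_val {V : Weil1} (f g : W ⟶ V) :
    (mulD f g).val (x 1 0) = f.val (x 1 0) * g.val (x 1 0) := by
  have h₁ : (desc f g).val xL = f.val (x 1 0) := descRing_inl _ _ _
  have h₂ : (desc f g).val xR = g.val (x 1 0) := descRing_inr _ _ _
  rw [mulD, comp_val, liftW_val, val_mul, h₁, h₂]

/-- The zero of `D`. -/
noncomputable def zeroD (V : Weil1) : W ⟶ V := aug 1 ≫ fromUnit V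

theorem zeroD_val (V : Weil1) : (zeroD V).val (x 1 0) = 0 := by
  rw [zeroD, comp_val, aug_val, val_zero]

/-- The multiplication of `D + 1`. -/
noncomputable def mulEndo {V : Weil1} : Endo.{v} V → Endo.{v} V → Endo.{v} V
  | .inl f, .inl g => .inl ⟨mulD f.down g.down⟩
  | .inl f, .inr _ => .inl f
  | .inr _, b => b

/-- The multiplication of `D + 1`, as a morphism. -/
noncomputable def mul : endo.{v} ⊗ endo.{v} ⟶ endo.{v} :=
  WeilSpace.ofFun (fun V a => mulEndo (V := V) a.1 a.2) fun {U V} k a => by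
    obtain ⟨f | f, g | g⟩ := a
    · refine congrArg (fun t => Sum.inl (ULift.up t)) (W_hom_ext ?_)
      change (mulD (f.down ≫ k) (g.down ≫ k)).val _ = k.val ((mulD f.down g.down).val _)
      rw [mulD_val, mulD_val, val_mul]
      rfl
    · rfl
    · rfl
    · rfl

/-- The unit of `D + 1`. -/
noncomputable def one : 𝟙_ WeilSpace.{v} ⟶ endo.{v} :=
  WeilSpace.ofFun (fun V _ => (.inr PUnit.unit : Endo V)) fun _ _ => rfl

/-- The zero of `D + 1`. -/
noncomputable def zero (X : WeilSpace.{v}) : X ⟶ endo.{v} :=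
  WeilSpace.ofFun (fun V _ => (.inl ⟨zeroD V⟩ : Endo V)) fun {U V} k a =>
    congrArg (fun t => Sum.inl (ULift.up t)) (W_hom_ext (by
      rw [zeroD_val, comp_val, zeroD_val, val_zero]))

/-- The morphism to the terminal Weil space. -/
noncomputable def toUnit (X : WeilSpace.{v}) : X ⟶ 𝟙_ WeilSpace.{v} :=
  WeilSpace.ofFun (fun _ _ => PUnit.unit) fun _ _ => rfl

theorem toUnit_ext {X : WeilSpace.{v}} (f g : X ⟶ 𝟙_ WeilSpace.{v}) : f = g :=
  WeilSpace.hom_ext fun _ _ => rfl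

/-- The Weil spaces of morphisms of `Λ⁺`: the endomorphisms of `total` form `D + 1`, and all other
hom-objects are terminal. -/
noncomputable def hom : LambdaPlus → LambdaPlus → WeilSpace.{v}
  | total, total => endo
  | _, _ => 𝟙_ _

/-- The identities of `Λ⁺`. -/
noncomputable def id : ∀ X : LambdaPlus, 𝟙_ WeilSpace.{v} ⟶ hom X X
  | base => 𝟙 _
  | total => one

/-- The composition of `Λ⁺`. -/
noncomputable def comp : ∀ X Y Z : LambdaPlus, hom.{v} X Y ⊗ hom.{v} Y Z ⟶ hom.{v} X Z
  | total, total, total => mul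
  | total, base, total => zero _
  | base, _, base => toUnit _
  | base, _, total => toUnit _
  | total, _, base => toUnit _

theorem one_mul (V : Weil1) (a : Endo.{v} V) : mulEndo (.inr PUnit.unit) a = a := rfl

theorem mul_one (V : Weil1) (a : Endo.{v} V) : mulEndo a (.inr PUnit.unit) = a := by
  obtain f | f := a <;> rfl

theorem mul_assoc (V : Weil1) (a b c : Endo.{v} V) :
    mulEndo (mulEndo a b) c = mulEndo a (mulEndo b c) := by
  obtain f | f := a <;> obtain g | g := b <;> obtain h | h := c
  · refine congrArg (fun t => Sum.inl (ULift.up t)) (W_hom_ext ?_)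
    change (mulD (mulD _ _) _).val _ = (mulD _ (mulD _ _)).val _
    simp only [mulD_val, _root_.mul_assoc]
  all_goals rfl

theorem zero_mul (V : Weil1) (a : Endo.{v} V) :
    mulEndo (.inl ⟨zeroD V⟩) a = .inl ⟨zeroD V⟩ := by
  obtain f | f := a
  · refine congrArg (fun t => Sum.inl (ULift.up t)) (W_hom_ext ?_)
    rw [mulD_val, zeroD_val, MulZeroClass.zero_mul]
  · rfl

theorem mul_zero (V : Weil1) (a : Endo.{v} V) :
    mulEndo a (.inl ⟨zeroD V⟩) = .inl ⟨zeroD V⟩ := by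
  obtain f | f := a
  · refine congrArg (fun t => Sum.inl (ULift.up t)) (W_hom_ext ?_)
    rw [mulD_val, zeroD_val, MulZeroClass.mul_zero]
  · rfl

/-- The enriched category `Λ⁺`. -/
noncomputable instance : EnrichedCategory WeilSpace.{v} LambdaPlus where
  Hom := hom
  id := id
  comp := comp
  id_comp
    | total, total => WeilSpace.hom_ext fun V a => one_mul V a
    | total, base => toUnit_ext _ _
    | base, total => toUnit_ext _ _
    | base, base => toUnit_ext _ _
  comp_id
    | total, total => WeilSpace.hom_ext fun V a => mul_one V a
    | total, base => toUnit_ext _ _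
    | base, total => toUnit_ext _ _
    | base, base => toUnit_ext _ _
  assoc
    | base, _, _, base => toUnit_ext _ _
    | base, _, _, total => toUnit_ext _ _
    | total, _, _, base => toUnit_ext _ _
    | total, total, total, total => WeilSpace.hom_ext fun V a => mul_assoc V a.1 a.2.1 a.2.2
    | total, total, base, total => WeilSpace.hom_ext fun V a => (mul_zero V a.1).symm
    | total, base, total, total => WeilSpace.hom_ext fun V a => zero_mul V a.2.2
    | total, base, base, total => WeilSpace.hom_ext fun _ _ => rfl

end LambdaPlus

/-! ### Enriched functor categories -/

namespace EnrichedNat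

variable {V : Type*} [Category* V] [MonoidalCategory V]

section

variable {D : Type*} [EnrichedCategory V D]

/-- Precomposition with a point of a hom-object. -/
def pre {A B : D} (a : 𝟙_ V ⟶ (A ⟶[V] B)) (Z : D) : (B ⟶[V] Z) ⟶ (A ⟶[V] Z) :=
  (λ_ _).inv ≫ a ▷ _ ≫ eComp V A B Z

/-- Postcomposition with a point of a hom-object. -/
def post {B Z : D} (A : D) (b : 𝟙_ V ⟶ (B ⟶[V] Z)) : (A ⟶[V] B) ⟶ (A ⟶[V] Z) :=
  (ρ_ _).inv ≫ _ ◁ b ≫ eComp V A B Z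

/-- The composite of two points. -/
def comp {A B Z : D} (a : 𝟙_ V ⟶ (A ⟶[V] B)) (b : 𝟙_ V ⟶ (B ⟶[V] Z)) : 𝟙_ V ⟶ (A ⟶[V] Z) :=
  (λ_ _).inv ≫ (a ⊗ₘ b) ≫ eComp V A B Z

theorem comp_eq_post {A B Z : D} (a : 𝟙_ V ⟶ (A ⟶[V] B)) (b : 𝟙_ V ⟶ (B ⟶[V] Z)) :
    comp a b = a ≫ post A b := by
  simp only [comp, post, MonoidalCategory.tensorHom_def, Category.assoc, rightUnitor_inv_naturality_assoc,
    unitors_inv_equal]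

theorem comp_eq_pre {A B Z : D} (a : 𝟙_ V ⟶ (A ⟶[V] B)) (b : 𝟙_ V ⟶ (B ⟶[V] Z)) :
    comp a b = b ≫ pre a Z := by
  simp only [comp, pre, tensorHom_def', Category.assoc, leftUnitor_inv_naturality_assoc]

theorem pre_id (A Z : D) : pre (eId V A) Z = 𝟙 _ := e_id_comp V A Z

theorem post_id (A B : D) : post A (eId V B) = 𝟙 _ := e_comp_id V A B

theorem eComp_post (A : D) {B Y Z : D} (b : 𝟙_ V ⟶ (Y ⟶[V] Z)) :
    eComp V A B Y ≫ post A b = _ ◁ post B b ≫ eComp V A B Z := by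
  simp only [post, Category.assoc, MonoidalCategory.whiskerLeft_comp]
  rw [rightUnitor_inv_naturality_assoc, ← whisker_exchange_assoc, ← e_assoc]
  simp

theorem eComp_pre {A B : D} (a : 𝟙_ V ⟶ (A ⟶[V] B)) (Y Z : D) :
    eComp V B Y Z ≫ pre a Z = pre a Y ▷ _ ≫ eComp V A Y Z := by
  simp only [pre, Category.assoc, comp_whiskerRight]
  rw [leftUnitor_inv_naturality_assoc, whisker_exchange_assoc, ← e_assoc']
  simp

theorem pre_post {A B Y Z : D} (a : 𝟙_ V ⟶ (A ⟶[V] B)) (b : 𝟙_ V ⟶ (Y ⟶[V] Z)) :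
    post B b ≫ pre a Z = pre a Y ≫ post A b := by
  conv_rhs => rw [pre, Category.assoc, Category.assoc, eComp_post, ← whisker_exchange_assoc,
    ← leftUnitor_inv_naturality_assoc]
  rfl

theorem post_comp {A B Y Z : D} (a : 𝟙_ V ⟶ (B ⟶[V] Y)) (b : 𝟙_ V ⟶ (Y ⟶[V] Z)) :
    post A (comp a b) = post A a ≫ post A b := by
  conv_rhs => rw [post, Category.assoc, Category.assoc, eComp_post, ← whiskerLeft_comp_assoc,
    ← comp_eq_post]
  rfl

theorem pre_comp {A B Y Z : D} (a : 𝟙_ V ⟶ (A ⟶[V] B)) (b : 𝟙_ V ⟶ (B ⟶[V] Y)) :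
    pre (comp a b) Z = pre b Z ≫ pre a Z := by
  conv_rhs => rw [pre, Category.assoc, Category.assoc, eComp_pre, ← comp_whiskerRight_assoc,
    ← comp_eq_pre]
  rfl

end

end EnrichedNat

/-- The type of `V`-functors from `B` to `D`. -/
structure VFunctor (V : Type*) [Category* V] [MonoidalCategory V] (B : Type*)
    [EnrichedCategory V B] (D : Type*) [EnrichedCategory V D] where
  toEnrichedFunctor : EnrichedFunctor V B D

namespace VFunctor

variable {V : Type*} [Category* V] [MonoidalCategory V] {B : Type*}
    [EnrichedCategory V B] {D : Type*} [EnrichedCategory V D]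

/-- A `V`-natural transformation: a family of points of the hom-objects such that the two composites
`B(X, Y) ⟶ D(F X, G Y)` agree. -/
@[ext]
structure NatTrans (F G : VFunctor V B D) where
  app (X : B) : 𝟙_ V ⟶ (F.toEnrichedFunctor.obj X ⟶[V] G.toEnrichedFunctor.obj X)
  naturality (X Y : B) :
    (ρ_ _).inv ≫ (F.toEnrichedFunctor.map X Y ⊗ₘ app Y) ≫ eComp V _ _ _ =
      (λ_ _).inv ≫ (app X ⊗ₘ G.toEnrichedFunctor.map X Y) ≫ eComp V _ _ _

open EnrichedNat

theorem naturality_iff (F G : VFunctor V B D)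
    (app : ∀ X : B, 𝟙_ V ⟶ (F.toEnrichedFunctor.obj X ⟶[V] G.toEnrichedFunctor.obj X)) (X Y : B) :
    (ρ_ _).inv ≫ (F.toEnrichedFunctor.map X Y ⊗ₘ app Y) ≫ eComp V _ _ _ =
      (λ_ _).inv ≫ (app X ⊗ₘ G.toEnrichedFunctor.map X Y) ≫ eComp V _ _ _ ↔
    F.toEnrichedFunctor.map X Y ≫ post _ (app Y) = G.toEnrichedFunctor.map X Y ≫ pre (app X) _ := by
  rw [MonoidalCategory.tensorHom_def, tensorHom_def']
  simp only [post, pre, Category.assoc, rightUnitor_inv_naturality_assoc,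
    leftUnitor_inv_naturality_assoc]

instance : Category (VFunctor V B D) where
  Hom := NatTrans
  id F := ⟨fun X => eId V _, fun X Y => by
    refine (naturality_iff F F (fun X => eId V (F.toEnrichedFunctor.obj X)) X Y).mpr ?_
    rw [pre_id, post_id]⟩
  comp {F G H} α β := ⟨fun X => (λ_ _).inv ≫ (α.app X ⊗ₘ β.app X) ≫ eComp V _ _ _, fun X Y => by
    have h₁ := (naturality_iff _ _ _ _ _).mp (α.naturality X Y)
    have h₂ := (naturality_iff _ _ _ _ _).mp (β.naturality X Y)
    refine (naturality_iff F H (fun X => comp (α.app X) (β.app X)) X Y).mpr ?_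
    rw [post_comp, pre_comp, reassoc_of% h₁, ← pre_post, reassoc_of% h₂]⟩
  id_comp α := NatTrans.ext (funext fun X => (comp_eq_pre _ _).trans (by
    rw [pre_id, Category.comp_id]))
  comp_id α := NatTrans.ext (funext fun X => (comp_eq_post _ _).trans (by
    rw [post_id, Category.comp_id]))
  assoc α β γ := NatTrans.ext (funext fun X => by
    change comp (comp _ _) _ = comp _ (comp _ _)
    rw [comp_eq_post, comp_eq_post, comp_eq_post _ (comp _ _), post_comp, Category.assoc])

end VFunctor

/-! ### From enriched functors to pre-differential bundles -/

section Comparison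

open MonoidalLeftAction

variable {C : Type u} [Category.{v} C]

/-- The action of `Weil1` on `C` presents the tangent structure: the action of the algebra
`W = ℕ[x] / x²` is the tangent functor, and the structure maps of the tangent structure are the
actions of the corresponding morphisms of Weil algebras. -/
structure WeilPresentation (𝕋 : TangentStructure C) [MonoidalLeftAction Weil1 C] where
  θ (X : C) : Weil1.W ⊙ₗ X ≅ 𝕋.T.obj X
  naturality {X Y : C} (f : X ⟶ Y) : Weil1.W ⊴ₗ f ≫ (θ Y).hom = (θ X).hom ≫ 𝕋.T.map f
  p_eq (X : C) : (θ X).hom ≫ 𝕋.p.app X = Weil1.aug 1 ⊵ₗ X ≫ (λₗ X).hom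
  zero_eq (X : C) : (λₗ X).inv ≫ Weil1.fromUnit Weil1.W ⊵ₗ X ≫ (θ X).hom = 𝕋.zero.app X
  add_eq (X : C) (t : Weil1.Wn 2 ⊙ₗ X ⟶ 𝕋.T₂.obj X)
    (h₀ : t ≫ 𝕋.π₀.app X = Weil1.fstW 1 1 ⊵ₗ X ≫ (θ X).hom)
    (h₁ : t ≫ 𝕋.π₁.app X = Weil1.sndW 1 1 ⊵ₗ X ≫ (θ X).hom) :
    t ≫ 𝕋.add.app X = Weil1.addW ⊵ₗ X ≫ (θ X).hom
  ℓ_eq (X : C) : (θ X).hom ≫ 𝕋.ℓ.app X = Weil1.liftW ⊵ₗ X ≫ (αₗ Weil1.W Weil1.W X).hom ≫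
    Weil1.W ⊴ₗ (θ X).hom ≫ (θ (𝕋.T.obj X)).hom
  c_eq (X : C) : ((αₗ Weil1.W Weil1.W X).hom ≫ Weil1.W ⊴ₗ (θ X).hom ≫
      (θ (𝕋.T.obj X)).hom) ≫ 𝕋.c.app X =
    Weil1.flipW ⊵ₗ X ≫ (αₗ Weil1.W Weil1.W X).hom ≫ Weil1.W ⊴ₗ (θ X).hom ≫
      (θ (𝕋.T.obj X)).hom

/-- The category of Weil-enriched functors and Weil-enriched natural transformations from `Λ⁺`
to `C`. -/
abbrev LambdaFunctors (C : Type u) [Category.{v} C] [MonoidalLeftAction Weil1 C]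
    [IsTangentAction C] : Type (max u v) := VFunctor WeilSpace.{v} LambdaPlus C

variable [MonoidalLeftAction Weil1 C] [IsTangentAction C]

namespace LambdaFunctors

open LambdaPlus

/-- The morphism `A ⟶ ℕ ⊙ B ≅ B` underlying a point of the Weil space of morphisms. -/
noncomputable def point {A B : C} (f : 𝟙_ WeilSpace.{v} ⟶ WeilEnrichment.hom A B) : A ⟶ B :=
  WeilSpace.val f (𝟙_ Weil1) PUnit.unit ≫ (λₗ B).hom

theorem map_compFun (F : LambdaFunctors C) (X Y Z : LambdaPlus) (V : Weil1)
    (a : (LambdaPlus.hom.{v} X Y).obj.obj V) (b : (LambdaPlus.hom.{v} Y Z).obj.obj V) :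
    WeilSpace.val (F.toEnrichedFunctor.map X Z) V (WeilSpace.val (LambdaPlus.comp X Y Z) V (a, b)) =
      WeilEnrichment.compFun (V := V) (WeilSpace.val (F.toEnrichedFunctor.map X Y) V a)
        (WeilSpace.val (F.toEnrichedFunctor.map Y Z) V b) :=
  WeilSpace.val_congr (F.toEnrichedFunctor.map_comp X Y Z) V (a, b)

theorem map_idFun (F : LambdaFunctors C) (X : LambdaPlus) (V : Weil1) :
    WeilSpace.val (F.toEnrichedFunctor.map X X) V
      (WeilSpace.val (LambdaPlus.id.{v} X) V PUnit.unit) = WeilEnrichment.idFun V _ :=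
  WeilSpace.val_congr (F.toEnrichedFunctor.map_id X) V PUnit.unit

/-- The lift `E ⟶ W ⊙ E`. -/
noncomputable def lift (F : LambdaFunctors C) :
    F.toEnrichedFunctor.obj total ⟶ Weil1.W ⊙ₗ F.toEnrichedFunctor.obj total :=
  WeilSpace.val (F.toEnrichedFunctor.map total total) Weil1.W
    (Sum.inl ⟨𝟙 Weil1.W⟩ : Endo.{v} Weil1.W)

theorem map_inl (F : LambdaFunctors C) {V : Weil1} (k : Weil1.W ⟶ V) :
    WeilSpace.val (F.toEnrichedFunctor.map total total) V (Sum.inl ⟨k⟩ : Endo.{v} V) =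
      lift F ≫ k ⊵ₗ _ := by
  have h := WeilSpace.val_naturality (F.toEnrichedFunctor.map total total) k
    (Sum.inl ⟨𝟙 Weil1.W⟩ : Endo.{v} Weil1.W)
  refine (congrArg (fun l => WeilSpace.val (F.toEnrichedFunctor.map total total) V
    (Sum.inl ⟨l⟩ : Endo.{v} V)) (Category.id_comp k).symm).trans h

theorem lift_lift (F : LambdaFunctors C) :
    lift F ≫ Weil1.W ⊴ₗ lift F =
      lift F ≫ Weil1.liftW ⊵ₗ _ ≫ (αₗ Weil1.W Weil1.W _).hom := by
  have h := map_compFun F total total total (Weil1.W ⊗ Weil1.W)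
    (Sum.inl ⟨Weil1.inl Weil1.W Weil1.W⟩ : Endo.{v} (Weil1.W ⊗ Weil1.W))
    (Sum.inl ⟨Weil1.inr Weil1.W Weil1.W⟩ : Endo.{v} (Weil1.W ⊗ Weil1.W))
  have e : mulD (Weil1.inl Weil1.W Weil1.W) (Weil1.inr Weil1.W Weil1.W) = Weil1.liftW :=
    W_hom_ext ((mulD_val _ _).trans liftW_val.symm)
  rw [map_inl, map_inl] at h
  have h' := (map_inl F (mulD (Weil1.inl Weil1.W Weil1.W) (Weil1.inr Weil1.W Weil1.W))).symm.trans
    (h.trans (WeilEnrichment.compFun_inl_inr (lift F) (lift F)))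
  rw [e] at h'
  have h'' := congrArg (fun k => k ≫ (αₗ Weil1.W Weil1.W _).hom) h'
  simp only [Category.assoc, Iso.inv_hom_id, Category.comp_id] at h''
  exact h''.symm

theorem point_comp {A B D : C} (f : 𝟙_ WeilSpace.{v} ⟶ WeilEnrichment.hom A B)
    (g : 𝟙_ WeilSpace.{v} ⟶ WeilEnrichment.hom B D) :
    WeilEnrichment.compFun (WeilSpace.val f (𝟙_ Weil1) PUnit.unit)
      (WeilSpace.val g (𝟙_ Weil1) PUnit.unit) ≫ (λₗ D).hom = point f ≫ point g :=
  WeilEnrichment.compFun_unit _ _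

theorem val_point {A B : C} (f : 𝟙_ WeilSpace.{v} ⟶ WeilEnrichment.hom A B) (V : Weil1) :
    WeilSpace.val f V PUnit.unit = point f ≫ WeilEnrichment.idFun V B := by
  have h (a : A ⟶ 𝟙_ Weil1 ⊙ₗ B) :
      a ≫ Weil1.fromUnit V ⊵ₗ B = (a ≫ (λₗ B).hom) ≫ WeilEnrichment.idFun V B := by
    rw [WeilEnrichment.idFun, Category.assoc, Iso.hom_inv_id_assoc]
  exact (WeilSpace.val_naturality f (Weil1.fromUnit V) PUnit.unit).trans
    (h (WeilSpace.val f (𝟙_ Weil1) PUnit.unit))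

/-- The projection `E ⟶ M`. -/
noncomputable def proj (F : LambdaFunctors C) :
    F.toEnrichedFunctor.obj total ⟶ F.toEnrichedFunctor.obj base :=
  point (F.toEnrichedFunctor.map total base)

/-- The section `M ⟶ E`. -/
noncomputable def sec (F : LambdaFunctors C) :
    F.toEnrichedFunctor.obj base ⟶ F.toEnrichedFunctor.obj total :=
  point (F.toEnrichedFunctor.map base total)

theorem sec_proj (F : LambdaFunctors C) : sec F ≫ proj F = 𝟙 _ := by
  have h := map_compFun F base total base (𝟙_ Weil1) PUnit.unit PUnit.unit
  have h' := map_idFun F base (𝟙_ Weil1)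
  refine (point_comp _ _).symm.trans ((congrArg (fun k => k ≫ (λₗ _).hom) (h.symm.trans h')).trans ?_)
  exact WeilEnrichment.idFun_unit _

theorem proj_sec (F : LambdaFunctors C) :
    proj F ≫ sec F = lift F ≫ Weil1.aug 1 ⊵ₗ _ ≫ (λₗ _).hom := by
  have h := map_compFun F total base total (𝟙_ Weil1) PUnit.unit PUnit.unit
  have h' := map_inl F (zeroD (𝟙_ Weil1))
  have e : zeroD (𝟙_ Weil1) = Weil1.aug 1 :=
    W_hom_ext ((zeroD_val _).trans aug_val.symm)
  rw [e] at h'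
  refine (point_comp _ _).symm.trans ((congrArg (fun k => k ≫ (λₗ _).hom) (h.symm.trans ?_)).trans
    (Category.assoc _ _ _))
  refine Eq.trans ?_ h'
  rw [← e]
  rfl

/-- The map of total spaces of an enriched natural transformation. -/
noncomputable def mapTotal {F G : LambdaFunctors C} (α : F ⟶ G) :
    F.toEnrichedFunctor.obj total ⟶ G.toEnrichedFunctor.obj total :=
  point (α.app total)

theorem mapTotal_lift {F G : LambdaFunctors C} (α : F ⟶ G) :
    mapTotal α ≫ lift G = lift F ≫ Weil1.W ⊴ₗ mapTotal α := by
  have h : WeilEnrichment.compFun (lift F) (WeilSpace.val (α.app total) Weil1.W PUnit.unit) =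
      WeilEnrichment.compFun (WeilSpace.val (α.app total) Weil1.W PUnit.unit) (lift G) :=
    WeilSpace.val_congr (α.naturality total total) Weil1.W
      (Sum.inl ⟨𝟙 Weil1.W⟩ : Endo.{v} Weil1.W)
  have e : WeilSpace.val (α.app total) Weil1.W PUnit.unit =
    mapTotal α ≫ WeilEnrichment.idFun Weil1.W _ := val_point _ _
  rw [e] at h
  exact (WeilEnrichment.comp_idFun_compFun _ _).symm.trans
    (h.symm.trans (WeilEnrichment.compFun_comp_idFun _ _))

/-- The pre-differential bundle of an enriched functor on `Λ⁺`. -/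
noncomputable def toPreObj {𝕋 : TangentStructure C} (θ : WeilPresentation 𝕋)
    (F : LambdaFunctors C) : PreDiffBundle 𝕋 where
  E := F.toEnrichedFunctor.obj total
  M := F.toEnrichedFunctor.obj base
  q := proj F
  ξ := sec F
  lam := lift F ≫ (θ.θ _).hom
  lam_lam := by
    rw [Category.assoc, ← θ.naturality, Category.assoc, θ.ℓ_eq, actionHomRight_comp,
      Category.assoc, reassoc_of% (lift_lift F)]
  ξ_q := sec_proj F
  q_ξ := by rw [proj_sec, Category.assoc, θ.p_eq]

/-- The comparison functor, which sends an enriched functor on `Λ⁺` to its total space with its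
lift, and an enriched natural transformation to its component at the total space. -/
noncomputable def toPre {𝕋 : TangentStructure C} (θ : WeilPresentation 𝕋) :
    LambdaFunctors C ⥤ PreDiffBundle 𝕋 where
  obj F := toPreObj θ F
  map {F G} α :=
    { f := mapTotal α
      comm := by
        change mapTotal α ≫ lift G ≫ (θ.θ _).hom = (lift F ≫ (θ.θ _).hom) ≫ 𝕋.T.map (mapTotal α)
        rw [Category.assoc, ← θ.naturality, reassoc_of% (mapTotal_lift α)] }
  map_id F := PreDiffBundle.Hom.ext (WeilEnrichment.idFun_unit _)
  map_comp α β := PreDiffBundle.Hom.ext (point_comp (α.app total) (β.app total))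

end LambdaFunctors

end Comparison

/-! ### Reflections given by the equalizer -/

/-- For a category `X` over the category of pre-differential bundles (by `Φ`) and a reflective
functor `I` from differential bundles to `X`: the reflector is given by the `T`-equalizer of
`T lam` and `ℓ` on `T E`, and the induced monad on `X` is idempotent and left exact, with
the differential bundles as its algebras. -/
structure IsEqualizerReflection {C : Type u} [Category.{v} C] {𝕋 : TangentStructure C}
    {X : Type*} [Category* X] (Φ : X ⥤ PreDiffBundle 𝕋) (I : DiffBundle 𝕋 ⥤ X) [Reflective I] :
    Prop where
  /-- The total space of the reflection of `P` is the `T`-equalizer of `T lam` and `ℓ`; its lift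
  is the restriction of `ℓ`, and the unit is induced by `lam`. -/
  equalizer (P : X) :
    ∃ ι : (Φ.obj (I.obj ((reflector I).obj P))).E ⟶ 𝕋.T.obj (Φ.obj P).E,
      𝕋.IsTEqualizer ι (𝕋.T.map (Φ.obj P).lam) (𝕋.ℓ.app (Φ.obj P).E) ∧
      (Φ.obj (I.obj ((reflector I).obj P))).lam ≫ 𝕋.T.map ι = ι ≫ 𝕋.ℓ.app (Φ.obj P).E ∧
      (Φ.map ((reflectorAdjunction I).unit.app P)).f ≫ ι = (Φ.obj P).lam
  /-- The monad is idempotent. -/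
  idempotent : IsIso (reflectorAdjunction I).toMonad.μ
  /-- The algebras of the monad are the differential bundles. -/
  algebras : (Monad.comparison (reflectorAdjunction I)).IsEquivalence
  /-- An object carries an algebra structure if and only if it is a differential bundle. -/
  algebra_iff (P : X) : Nonempty {A : (reflectorAdjunction I).toMonad.Algebra // A.A = P} ↔
    PreDiffBundle.IsDiffBundle 𝕋 (Φ.obj P)
  /-- The monad preserves finite limits that are computed as `T`-limits of total spaces. -/
  preserves_T_limits {J : Type} [SmallCategory J] [FinCategory J] {K : J ⥤ X} (s : Cone K)
    (hs : 𝕋.IsTLimit ((Φ ⋙ PreDiffBundle.total).mapCone s)) :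
    𝕋.IsTLimit ((Φ ⋙ PreDiffBundle.total).mapCone ((reflector I ⋙ I).mapCone s))
  preserves_pullbacks : PreservesLimitsOfShape WalkingCospan (reflector I ⋙ I)
  preserves_equalizers : PreservesLimitsOfShape WalkingParallelPair (reflector I ⋙ I)
  preserves_terminal : PreservesLimitsOfShape (Discrete PEmpty.{1}) (reflector I ⋙ I)

/-!
In a category with `T`-equalizers and `T`-pullbacks all equalizers and pullbacks are `T`-limits, as
limits are unique up to isomorphism. So the pullback powers in the definition of a differential
bundle are automatic (`isDiffBundle_iff`), and a differential bundle is a pre-differential bundle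
whose lift is non-singular.

Let `(E, lam)` be a lift and `ι : E' ⟶ T E` the equalizer of `T lam` and `ℓ`. As `T` preserves `ι`, the
lift `ℓ` restricts to `E'`, and `lam` factors through `ι` by a morphism of lifts `u : E ⟶ E'`
(`exists_isEqualizerArrow`). The universality of `ℓ` says that the free lift `ℓ` on `T E` is
non-singular (`exists_comp_ℓ`), and as `T ι` is monic this passes to `E'`
(`IsEqualizerArrow.isNonsingular`). On the other hand, a non-singular lift `F ⟶ T F` is itself the
equalizer of `T lam` and `ℓ` (`IsNonsingular.isEqualizerOf`). So for every morphism of lifts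
`f : E ⟶ F` the composite `T f ∘ ι` lifts to `E' ⟶ F`, and this is the only factorization of `f`
through `u`, because the lift of `E'` is `T u ∘ ι` (`IsEqualizerArrow.exists_factor`,
`IsEqualizerArrow.hom_ext`). This gives the reflection. Its monad is idempotent with the differential
bundles as algebras by the general theory of reflective subcategories. It preserves `T`-limits because
these commute with equalizers; this covers all pullbacks and equalizers of pre-differential bundles,
which are computed as `T`-limits of total spaces (`isTLimit_total_of_isLimit`). Terminal objects are
preserved by any reflector.

An enriched functor on `Λ⁺` consists of an action of the semigroup `D` on the total space, which by
the Yoneda lemma is a map `E ⟶ W ⊙ E` compatible with the multiplication of `D`, that is a lift, and of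
a splitting of the idempotent by which `0` acts (`BundleData`). A natural transformation is determined
by its component at the total space, and every morphism of lifts is such a component. So the comparison
functor is fully faithful and bijective on objects (`exists_inverse_toPre`). The description of the
reflection is invariant under equivalence (`isEqualizerReflection`), so it carries over from
pre-differential bundles to enriched functors.
-/

/-! ### `T`-limits -/

namespace TangentStructure

variable {C : Type u} [Category.{v} C] {𝕋 : TangentStructure C}

variable (𝕋) in
/-- All diagrams of shape `J` have limits, and the iterates of `T` preserve these. -/
structure HasTLimitsOfShape (J : Type*) [Category J] : Prop where
  hasLimits : HasLimitsOfShape J C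
  preserves (n : ℕ) : PreservesLimitsOfShape J (𝕋.iter n)

theorem HasTLimitsOfShape.isTLimit {J : Type*} [Category J] (h : 𝕋.HasTLimitsOfShape J)
    {K : J ⥤ C} {s : Cone K} (hs : IsLimit s) : 𝕋.IsTLimit s := fun n =>
  have := h.preserves n
  ⟨isLimitOfPreserves _ hs⟩

theorem IsTLimit.isLimit {J : Type*} [Category J] {K : J ⥤ C} {s : Cone K} (h : 𝕋.IsTLimit s) :
    Nonempty (IsLimit s) := h 0

theorem IsTLimit.isLimit_T {J : Type*} [Category J] {K : J ⥤ C} {s : Cone K}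
    (h : 𝕋.IsTLimit s) : Nonempty (IsLimit (𝕋.T.mapCone s)) := h 1

theorem iter_comp_T (n : ℕ) : 𝕋.T ⋙ 𝕋.iter n = 𝕋.iter (n + 1) := by
  induction n with
  | zero => rfl
  | succ n ih => exact congrArg (· ⋙ 𝕋.T) ih

theorem IsTLimit.map_T {J : Type*} [Category J] {K : J ⥤ C} {s : Cone K}
    (h : 𝕋.IsTLimit s) : 𝕋.IsTLimit (𝕋.T.mapCone s) := fun n => by
  have h' : Nonempty (IsLimit ((𝕋.T ⋙ 𝕋.iter n).mapCone s)) := by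
    rw [iter_comp_T]
    exact h (n + 1)
  exact h'

theorem hasTLimitsOfShape_of_exists {J : Type*} [Category J]
    (h : ∀ K : J ⥤ C, ∃ (K' : J ⥤ C) (_ : K' ≅ K) (s : Cone K'), 𝕋.IsTLimit s) :
    𝕋.HasTLimitsOfShape J where
  hasLimits := ⟨fun K => by
    obtain ⟨K', e, s, hs⟩ := h K
    have : HasLimit K' := ⟨⟨s, hs.isLimit.some⟩⟩
    exact hasLimit_of_iso e⟩
  preserves n := ⟨fun {K} => by
    obtain ⟨K', e, s, hs⟩ := h K
    have := preservesLimit_of_preserves_limit_cone hs.isLimit.some (hs n).some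
    exact preservesLimit_of_iso_diagram _ e⟩

theorem HasTEqualizers.hasTLimitsOfShape (hE : 𝕋.HasTEqualizers) :
    𝕋.HasTLimitsOfShape WalkingParallelPair :=
  hasTLimitsOfShape_of_exists fun K => by
    obtain ⟨E, i, w, hi⟩ := hE (K.map .left) (K.map .right)
    exact ⟨_, (diagramIsoParallelPair K).symm, _, hi⟩

theorem HasTPullbacks.hasTLimitsOfShape (hP : 𝕋.HasTPullbacks) :
    𝕋.HasTLimitsOfShape WalkingCospan :=
  hasTLimitsOfShape_of_exists fun K => by
    obtain ⟨s, hs⟩ := hP (K.map WalkingCospan.Hom.inl) (K.map WalkingCospan.Hom.inr)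
    exact ⟨_, (diagramIsoCospan K).symm, _, hs⟩

end TangentStructure

section

variable {C : Type u} [Category.{v} C]

/-- The morphism `i` is an equalizer of `f` and `g`. -/
structure IsEqualizerOf {E X Y : C} (i : E ⟶ X) (f g : X ⟶ Y) : Prop where
  w : i ≫ f = i ≫ g
  isLimit : Nonempty (IsLimit (Fork.ofι i w))

namespace IsEqualizerOf

variable {E X Y : C} {i : E ⟶ X} {f g : X ⟶ Y}

theorem mono (h : IsEqualizerOf i f g) : Mono i := mono_of_isLimit_fork h.isLimit.some

theorem exists_lift (h : IsEqualizerOf i f g) {Z : C} (k : Z ⟶ X) (hk : k ≫ f = k ≫ g) :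
    ∃ l : Z ⟶ E, l ≫ i = k :=
  ⟨Fork.IsLimit.lift h.isLimit.some k hk, Fork.IsLimit.lift_ι' h.isLimit.some k hk⟩

theorem of_exists_lift [Mono i] (w : i ≫ f = i ≫ g)
    (h : ∀ {Z : C} (k : Z ⟶ X), k ≫ f = k ≫ g → ∃ l : Z ⟶ E, l ≫ i = k) :
    IsEqualizerOf i f g :=
  ⟨w, ⟨Fork.IsLimit.mk _ (fun s => (h s.ι s.condition).choose)
    (fun s => (h s.ι s.condition).choose_spec)
    fun s m hm => by
      rw [← cancel_mono i]
      exact hm.trans (h s.ι s.condition).choose_spec.symm⟩⟩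

theorem map (h : IsEqualizerOf i f g) {D : Type*} [Category D] (F : C ⥤ D)
    [PreservesLimitsOfShape WalkingParallelPair F] :
    IsEqualizerOf (F.map i) (F.map f) (F.map g) :=
  ⟨by rw [← F.map_comp, h.w, F.map_comp],
    ⟨isLimitForkMapOfIsLimit F h.w h.isLimit.some⟩⟩

/-- Limits commute with equalizers. -/
theorem isLimit_cone {J : Type*} [Category J] {K L M : J ⥤ C} {a : Cone K} {b : Cone L}
    {d : Cone M} {ι : K ⟶ L} {f g : L ⟶ M} (h : ∀ j, IsEqualizerOf (ι.app j) (f.app j) (g.app j))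
    {i : a.pt ⟶ b.pt} {k l : b.pt ⟶ d.pt} (hi : IsEqualizerOf i k l)
    (hiι : ∀ j, i ≫ b.π.app j = a.π.app j ≫ ι.app j)
    (hk : ∀ j, k ≫ d.π.app j = b.π.app j ≫ f.app j)
    (hl : ∀ j, l ≫ d.π.app j = b.π.app j ≫ g.app j)
    (hb : IsLimit b) (hd : IsLimit d) : Nonempty (IsLimit a) := by
  have hm := hi.mono
  have key (s : Cone K) : ∃ m : s.pt ⟶ a.pt,
      m ≫ i = hb.lift ((Cone.postcompose ι).obj s) := by
    apply hi.exists_lift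
    apply hd.hom_ext
    intro j
    simp only [Category.assoc, hk, hl, hb.fac_assoc, Cone.postcompose_obj_π, NatTrans.comp_app,
      (h j).w]
  choose m hm using key
  refine ⟨⟨m, fun s j => ?_, fun s n hn => ?_⟩⟩
  · have := (h j).mono
    rw [← cancel_mono (ι.app j), Category.assoc, ← hiι, reassoc_of% (hm s), hb.fac]
    rfl
  · rw [← cancel_mono i, hm]
    apply hb.hom_ext
    intro j
    rw [hb.fac, Category.assoc, hiι, reassoc_of% (hn j)]
    rfl

end IsEqualizerOf

end

namespace TangentStructure

variable {C : Type u} [Category.{v} C] {𝕋 : TangentStructure C}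

theorem IsTEqualizer.isEqualizerOf {E X Y : C} {i : E ⟶ X} {f g : X ⟶ Y}
    (h : 𝕋.IsTEqualizer i f g) : IsEqualizerOf i f g := by
  obtain ⟨w, h⟩ := h
  exact ⟨w, h.isLimit⟩

theorem HasTEqualizers.isTEqualizer_iff (hE : 𝕋.HasTEqualizers) {E X Y : C} {i : E ⟶ X}
    {f g : X ⟶ Y} : 𝕋.IsTEqualizer i f g ↔ IsEqualizerOf i f g :=
  ⟨IsTEqualizer.isEqualizerOf, fun h => ⟨h.w, hE.hasTLimitsOfShape.isTLimit h.isLimit.some⟩⟩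

theorem HasTEqualizers.map_T (hE : 𝕋.HasTEqualizers) {E X Y : C} {i : E ⟶ X}
    {f g : X ⟶ Y} (h : IsEqualizerOf i f g) :
    IsEqualizerOf (𝕋.T.map i) (𝕋.T.map f) (𝕋.T.map g) :=
  have := hE.hasTLimitsOfShape.preserves 1
  h.map (𝕋.iter 1)

/-! ### Pullback powers -/

/-- The maps `π i : P ⟶ E` over `b : P ⟶ M` form a pullback power of `q : E ⟶ M`. -/
structure IsPullbackPower {E M P : C} (q : E ⟶ M) {n : ℕ} (b : P ⟶ M) (π : Fin n → (P ⟶ E)) :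
    Prop where
  w (i : Fin n) : π i ≫ q = b
  exists_lift {X : C} (y : X ⟶ M) (x : Fin n → (X ⟶ E)) (h : ∀ i, x i ≫ q = y) :
    ∃ l : X ⟶ P, l ≫ b = y ∧ ∀ i, l ≫ π i = x i
  hom_ext {X : C} {l m : X ⟶ P} (h : l ≫ b = m ≫ b) (h' : ∀ i, l ≫ π i = m ≫ π i) : l = m

theorem IsPullbackPower.zero {E M : C} (q : E ⟶ M) (π : Fin 0 → (M ⟶ E)) :
    IsPullbackPower q (𝟙 M) π where
  w i := i.elim0
  exists_lift y _ _ := ⟨y, Category.comp_id _, fun i => i.elim0⟩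
  hom_ext h _ := by simpa using h

theorem IsPullbackPower.succ {E M P : C} {q : E ⟶ M} {n : ℕ} {b : P ⟶ M} {π : Fin n → (P ⟶ E)}
    (h : IsPullbackPower q b π) {P' : C} {f : P' ⟶ E} {g : P' ⟶ P} (H : IsPullback f g q b)
    {b' : P' ⟶ M} {π' : Fin (n + 1) → (P' ⟶ E)} (hb : b' = g ≫ b) (h₀ : π' 0 = f)
    (h₁ : ∀ i : Fin n, π' i.succ = g ≫ π i) :
    IsPullbackPower q b' π' where
  w i := by
    subst hb
    refine Fin.cases ?_ (fun i => ?_) i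
    · rw [h₀, H.w]
    · rw [h₁, Category.assoc, h.w]
  exists_lift y x hx := by
    subst hb
    obtain ⟨l, hl, hl'⟩ := h.exists_lift y (fun i => x i.succ) fun i => hx i.succ
    refine ⟨H.lift (x 0) l (by rw [hx, hl]), by rw [H.lift_snd_assoc, hl], fun i => ?_⟩
    refine Fin.cases ?_ (fun i => ?_) i
    · rw [h₀, H.lift_fst]
    · rw [h₁, H.lift_snd_assoc, hl']
  hom_ext {X l m} e e' := by
    subst hb
    apply H.hom_ext
    · rw [← h₀, e']
    · apply h.hom_ext
      · simpa using e
      · intro i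
        simpa [h₁] using e' i.succ

/-- The cone over the cospans of copies of `q` given by `b` and `π`. -/
abbrev powerCone {E M P : C} {q : E ⟶ M} {n : ℕ} {b : P ⟶ M} {π : Fin n → (P ⟶ E)}
    (w : ∀ i, π i ≫ q = b) : Cone (WidePullbackShape.wideCospan M (fun _ : Fin n => E) fun _ => q) :=
  WidePullbackShape.mkCone b π w

theorem isLimit_map_powerCone {E M P : C} {q : E ⟶ M} {n : ℕ} {b : P ⟶ M} {π : Fin n → (P ⟶ E)}
    (w : ∀ i, π i ≫ q = b) (F : C ⥤ C)
    (h : IsPullbackPower (F.map q) (F.map b) fun i => F.map (π i)) :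
    Nonempty (IsLimit (F.mapCone (powerCone w))) := by
  have key (s : Cone (WidePullbackShape.wideCospan M (fun _ : Fin n => E) (fun _ => q) ⋙ F)) :
      ∃ l : s.pt ⟶ F.obj P, l ≫ F.map b = s.π.app none ∧
        ∀ i, l ≫ F.map (π i) = s.π.app (some i) :=
    h.exists_lift (s.π.app none) (fun i => s.π.app (some i)) fun i => by
      exact s.w (WidePullbackShape.Hom.term i)
  choose l hl hl' using key
  refine ⟨⟨l, fun s j => ?_, fun s m hm => ?_⟩⟩
  · cases j with
    | none => exact hl s
    | some i => exact hl' s i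
  · apply h.hom_ext
    · exact (hm none).trans (hl s).symm
    · intro i
      exact (hm (some i)).trans (hl' s i).symm

theorem HasTPullbacks.exists_isPullbackPower (hP : 𝕋.HasTPullbacks) {E M : C} (q : E ⟶ M) (n : ℕ) :
    ∃ (P : C) (b : P ⟶ M) (π : Fin n → (P ⟶ E)), ∀ k,
      IsPullbackPower ((𝕋.iter k).map q) ((𝕋.iter k).map b) fun i => (𝕋.iter k).map (π i) := by
  induction n with
  | zero => exact ⟨M, 𝟙 M, fun i => i.elim0, fun k => by
      rw [CategoryTheory.Functor.map_id]
      exact IsPullbackPower.zero _ _⟩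
  | succ n ih =>
    obtain ⟨P, b, π, h⟩ := ih
    have := hP.hasTLimitsOfShape.hasLimits
    refine ⟨pullback q b, pullback.snd q b ≫ b,
      Fin.cases (pullback.fst q b) fun i => pullback.snd q b ≫ π i, fun k => ?_⟩
    have := hP.hasTLimitsOfShape.preserves k
    exact (h k).succ ((IsPullback.of_hasPullback q b).map (𝕋.iter k)) (Functor.map_comp _ _ _)
      rfl fun i => Functor.map_comp _ _ _

theorem HasTPullbacks.exists_isTLimit_power (hP : 𝕋.HasTPullbacks) {E M : C} (q : E ⟶ M) (n : ℕ) :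
    ∃ s : Cone (WidePullbackShape.wideCospan M (fun _ : Fin n => E) fun _ => q), 𝕋.IsTLimit s := by
  obtain ⟨P, b, π, h⟩ := hP.exists_isPullbackPower q n
  exact ⟨powerCone (h 0).w, fun k => isLimit_map_powerCone _ _ (h k)⟩

end TangentStructure

/-! ### Lifts and their equalizers -/

namespace TangentStructure

variable {C : Type u} [Category.{v} C] (𝕋 : TangentStructure C)

theorem zero_T_map {X Y : C} (f : X ⟶ Y) :
    𝕋.zero.app X ≫ 𝕋.T.map f = f ≫ 𝕋.zero.app Y := (𝕋.zero.naturality f).symm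

theorem T_map_p {X Y : C} (f : X ⟶ Y) :
    𝕋.T.map f ≫ 𝕋.p.app Y = 𝕋.p.app X ≫ f := 𝕋.p.naturality f

theorem T_map_ℓ {X Y : C} (f : X ⟶ Y) :
    𝕋.T.map f ≫ 𝕋.ℓ.app Y = 𝕋.ℓ.app X ≫ 𝕋.T.map (𝕋.T.map f) := 𝕋.ℓ.naturality f

theorem ℓ_p_T (M : C) : 𝕋.ℓ.app M ≫ 𝕋.p.app (𝕋.T.obj M) = 𝕋.p.app M ≫ 𝕋.zero.app M := by
  rw [← 𝕋.ℓ_p, ← 𝕋.c_p, ← Category.assoc, 𝕋.ℓ_c]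

/-- Adding a zero vector in the fibre of `T p` changes nothing. -/
theorem T_zero_add {X M : C} (w : X ⟶ 𝕋.T.obj (𝕋.T.obj M))
    (k : X ⟶ 𝕋.T.obj (𝕋.T₂.obj M))
    (h₀ : k ≫ 𝕋.T.map (𝕋.π₀.app M) = w ≫ 𝕋.T.map (𝕋.p.app M) ≫ 𝕋.T.map (𝕋.zero.app M))
    (h₁ : k ≫ 𝕋.T.map (𝕋.π₁.app M) = w) : k ≫ 𝕋.T.map (𝕋.add.app M) = w := by
  have hk : k = w ≫ 𝕋.T.map ((𝕋.isPullback_T₂ M).lift (𝕋.p.app M ≫ 𝕋.zero.app M) (𝟙 _)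
      (by simp [𝕋.zero_p])) := by
    apply (𝕋.isPullback_T_T₂ M).hom_ext
    · rw [h₀, Category.assoc, ← 𝕋.T.map_comp, ← 𝕋.T.map_comp, IsPullback.lift_fst]
    · rw [h₁, Category.assoc, ← 𝕋.T.map_comp, IsPullback.lift_snd, 𝕋.T.map_id, Category.comp_id]
  rw [hk, Category.assoc, ← 𝕋.T.map_comp, 𝕋.zero_add, 𝕋.T.map_id, Category.comp_id]

/-- The zero vector is neutral on the right. -/
theorem add_zero_of_eq {X M : C} (x : X ⟶ 𝕋.T.obj M) (k : X ⟶ 𝕋.T₂.obj M)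
    (h₀ : k ≫ 𝕋.π₀.app M = x) (h₁ : k ≫ 𝕋.π₁.app M = x ≫ 𝕋.p.app M ≫ 𝕋.zero.app M) :
    k ≫ 𝕋.add.app M = x := by
  have hk : k ≫ (𝕋.isPullback_T₂ M).lift (𝕋.π₁.app M) (𝕋.π₀.app M) (𝕋.isPullback_T₂ M).w.symm =
      x ≫ (𝕋.isPullback_T₂ M).lift (𝕋.p.app M ≫ 𝕋.zero.app M) (𝟙 _) (by simp [𝕋.zero_p]) := by
    apply (𝕋.isPullback_T₂ M).hom_ext
    · rw [Category.assoc, Category.assoc, IsPullback.lift_fst, IsPullback.lift_fst, h₁]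
    · rw [Category.assoc, Category.assoc, IsPullback.lift_snd, IsPullback.lift_snd, h₀,
        Category.comp_id]
  rw [← 𝕋.add_comm, reassoc_of% hk, 𝕋.zero_add, Category.comp_id]

/-- The universality of the lift, for the map `μ : (x, y) ↦ T add (zero x, ℓ y)`: its composite with
the projection is the first component, and its restriction along `x = zero (p y)` is `ℓ`. -/
theorem exists_universal (M : C) : ∃ μ : 𝕋.T₂.obj M ⟶ 𝕋.T.obj (𝕋.T.obj M),
    IsPullback μ (𝕋.π₀.app M ≫ 𝕋.p.app M) (𝕋.T.map (𝕋.p.app M)) (𝕋.zero.app M) ∧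
    μ ≫ 𝕋.p.app (𝕋.T.obj M) = 𝕋.π₀.app M ∧
    ∀ {X : C} (t : X ⟶ 𝕋.T₂.obj M),
      t ≫ 𝕋.π₀.app M = t ≫ 𝕋.π₁.app M ≫ 𝕋.p.app M ≫ 𝕋.zero.app M →
        t ≫ μ = t ≫ 𝕋.π₁.app M ≫ 𝕋.ℓ.app M := by
  have hμ := 𝕋.universality M
  set k := (𝕋.isPullback_T_T₂ M).lift (𝕋.π₀.app M ≫ 𝕋.zero.app (𝕋.T.obj M))
    (𝕋.π₁.app M ≫ 𝕋.ℓ.app M) _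
  have hk₀ : k ≫ 𝕋.T.map (𝕋.π₀.app M) = 𝕋.π₀.app M ≫ 𝕋.zero.app (𝕋.T.obj M) :=
    IsPullback.lift_fst _ _ _ _
  have hk₁ : k ≫ 𝕋.T.map (𝕋.π₁.app M) = 𝕋.π₁.app M ≫ 𝕋.ℓ.app M := IsPullback.lift_snd _ _ _ _
  refine ⟨_, hμ, ?_, fun t ht => ?_⟩
  · have hπ := (𝕋.isPullback_T₂ M).w
    rw [Category.assoc, T_map_p, ← Category.assoc k]
    apply add_zero_of_eq
    · rw [Category.assoc, ← T_map_p, reassoc_of% hk₀, 𝕋.zero_p, Category.comp_id]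
    · rw [Category.assoc, ← T_map_p, reassoc_of% hk₁, ℓ_p_T, reassoc_of% hπ]
  · have hz := 𝕋.zero_T_map (𝕋.zero.app M)
    simp only [Functor.id_obj] at hz
    have hℓ := 𝕋.ℓ_p M
    rw [← Category.assoc t]
    apply T_zero_add
    · rw [Category.assoc, hk₀, Category.assoc, Category.assoc, reassoc_of% hℓ, hz,
        reassoc_of% ht]
    · rw [Category.assoc, hk₁]

/-- The free lift `ℓ` on `T M` is non-singular: an element `w` of `T² M` is in the image of `ℓ` as
soon as `T p w` and `p w` are both equal to `zero (p (p w))`. -/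
theorem exists_comp_ℓ {X M : C} (w : X ⟶ 𝕋.T.obj (𝕋.T.obj M))
    (hw : w ≫ 𝕋.T.map (𝕋.p.app M) = w ≫ 𝕋.p.app (𝕋.T.obj M) ≫ 𝕋.p.app M ≫ 𝕋.zero.app M)
    (hw' : w ≫ 𝕋.p.app (𝕋.T.obj M) =
      w ≫ 𝕋.p.app (𝕋.T.obj M) ≫ 𝕋.p.app M ≫ 𝕋.zero.app M) :
    ∃ y : X ⟶ 𝕋.T.obj M, y ≫ 𝕋.ℓ.app M = w := by
  obtain ⟨μ, hμ, hp, hℓ⟩ := 𝕋.exists_universal M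
  let t := hμ.lift w (w ≫ 𝕋.p.app (𝕋.T.obj M) ≫ 𝕋.p.app M) (by simpa using hw)
  have ht : t ≫ μ = w := hμ.lift_fst _ _ _
  have h₀ : t ≫ 𝕋.π₀.app M = w ≫ 𝕋.p.app (𝕋.T.obj M) := by
    rw [← ht, Category.assoc, hp]
  refine ⟨t ≫ 𝕋.π₁.app M, ?_⟩
  rw [Category.assoc, ← hℓ t, ht]
  have hπ := (𝕋.isPullback_T₂ M).w
  rw [← reassoc_of% hπ, reassoc_of% h₀, h₀]
  exact hw'

instance mono_ℓ (M : C) : Mono (𝕋.ℓ.app M) where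
  right_cancellation {X} y y' h := by
    obtain ⟨μ, hμ, hp, hℓ⟩ := 𝕋.exists_universal M
    let z : 𝕋.T.obj M ⟶ 𝕋.T₂.obj M :=
      (𝕋.isPullback_T₂ M).lift (𝕋.p.app M ≫ 𝕋.zero.app M) (𝟙 _) (by simp [𝕋.zero_p])
    have hz₀ : z ≫ 𝕋.π₀.app M = 𝕋.p.app M ≫ 𝕋.zero.app M := IsPullback.lift_fst _ _ _ _
    have hz₁ : z ≫ 𝕋.π₁.app M = 𝟙 _ := IsPullback.lift_snd _ _ _ _
    have key : z ≫ μ = 𝕋.ℓ.app M := by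
      rw [hℓ z (by rw [hz₀, reassoc_of% hz₁]), reassoc_of% hz₁]
    have hy : y ≫ 𝕋.p.app M = y' ≫ 𝕋.p.app M := by
      have := congrArg (fun f => f ≫ 𝕋.p.app _ ≫ 𝕋.p.app M) h
      have hℓp := 𝕋.ℓ_p_T M
      simpa [reassoc_of% hℓp, 𝕋.zero_p] using this
    have : y ≫ z = y' ≫ z := by
      apply hμ.hom_ext
      · rw [Category.assoc, Category.assoc, key, h]
      · rw [Category.assoc, Category.assoc, reassoc_of% hz₀, 𝕋.zero_p, Category.comp_id, hy]
    have := congrArg (fun f => f ≫ 𝕋.π₁.app M) this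
    simpa [hz₁] using this

end TangentStructure

namespace PreDiffBundle

variable {C : Type u} [Category.{v} C] {𝕋 : TangentStructure C}

open TangentStructure

/-- A generalized element of `T E` at which `T lam` and `ℓ` agree also equalizes the pair of maps in
the definition of non-singularity: apply `T p`. -/
theorem lift_T_idem (P : PreDiffBundle 𝕋) {X : C} {v : X ⟶ 𝕋.T.obj P.E}
    (h : v ≫ 𝕋.T.map P.lam = v ≫ 𝕋.ℓ.app P.E) :
    v ≫ 𝕋.ℓ.app P.E ≫ 𝕋.p.app (𝕋.T.obj P.E) = v ≫ 𝕋.T.map (P.lam ≫ 𝕋.p.app P.E) := by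
  rw [𝕋.T.map_comp, reassoc_of% h, ℓ_p_T, 𝕋.ℓ_p]

theorem lam_idem (P : PreDiffBundle 𝕋) :
    P.lam ≫ 𝕋.ℓ.app P.E ≫ 𝕋.p.app (𝕋.T.obj P.E) = P.lam ≫ 𝕋.T.map (P.lam ≫ 𝕋.p.app P.E) :=
  P.lift_T_idem P.lam_lam

/-- The lift of a non-singular bundle is the equalizer of `T lam` and `ℓ`, since the elements `lam x`
satisfy this equation, and it implies the one whose equalizer is `lam`. -/
theorem IsNonsingular.isEqualizerOf {P : PreDiffBundle 𝕋} (h : P.IsNonsingular) :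
    IsEqualizerOf P.lam (𝕋.T.map P.lam) (𝕋.ℓ.app P.E) := by
  have h' := IsTEqualizer.isEqualizerOf h
  have := h'.mono
  exact .of_exists_lift P.lam_lam fun k hk => h'.exists_lift k (P.lift_T_idem hk)

/-- The pullback powers in the definition of a differential bundle exist automatically, as `C` has
`T`-pullbacks. -/
theorem isDiffBundle_iff (hP : 𝕋.HasTPullbacks) (P : PreDiffBundle 𝕋) :
    IsDiffBundle 𝕋 P ↔ P.IsNonsingular :=
  and_iff_left fun n => hP.exists_isTLimit_power P.q n

/-- The total space of `Q` is, by way of `ι`, the equalizer of `T lam` and `ℓ` on `T E`, where `E` and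
`lam` are the total space and the lift of `P`; the lift of `Q` is the restriction of `ℓ`, and `u` is
the morphism induced by `lam`. -/
structure IsEqualizerArrow {P Q : PreDiffBundle 𝕋} (u : P ⟶ Q) (ι : Q.E ⟶ 𝕋.T.obj P.E) :
    Prop where
  isEqualizerOf : IsEqualizerOf ι (𝕋.T.map P.lam) (𝕋.ℓ.app P.E)
  lam_ι : Q.lam ≫ 𝕋.T.map ι = ι ≫ 𝕋.ℓ.app P.E
  u_ι : u.f ≫ ι = P.lam

/-- The endomorphism `p ∘ lam` of a lift is idempotent, so that it splits if `C` has equalizers. -/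
theorem exists_splitting (hE : 𝕋.HasTEqualizers) {E : C} (lam : E ⟶ 𝕋.T.obj E)
    (h : lam ≫ 𝕋.T.map lam = lam ≫ 𝕋.ℓ.app E) :
    ∃ (M : C) (q : E ⟶ M) (ξ : M ⟶ E), ξ ≫ q = 𝟙 M ∧ q ≫ ξ = lam ≫ 𝕋.p.app E := by
  have idem : (lam ≫ 𝕋.p.app E) ≫ lam ≫ 𝕋.p.app E = lam ≫ 𝕋.p.app E := by
    have h₁ := 𝕋.T_map_p lam
    have h₂ := 𝕋.ℓ_p_T E
    rw [Category.assoc, ← reassoc_of% h₁, reassoc_of% h, reassoc_of% h₂, 𝕋.zero_p]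
    simp
  obtain ⟨M, ξ, hξ⟩ := hE (lam ≫ 𝕋.p.app E) (𝟙 E)
  have hξ := hξ.isEqualizerOf
  have := hξ.mono
  obtain ⟨q, hq⟩ := hξ.exists_lift (lam ≫ 𝕋.p.app E) (by rw [idem, Category.comp_id])
  refine ⟨M, q, ξ, ?_, hq⟩
  rw [← cancel_mono ξ, Category.assoc, hq, hξ.w, Category.comp_id, Category.id_comp]

theorem exists_isEqualizerArrow (hE : 𝕋.HasTEqualizers) (P : PreDiffBundle 𝕋) :
    ∃ (Q : PreDiffBundle 𝕋) (u : P ⟶ Q) (ι : Q.E ⟶ 𝕋.T.obj P.E), IsEqualizerArrow u ι := by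
  obtain ⟨E', ι, hι⟩ := hE (𝕋.T.map P.lam) (𝕋.ℓ.app P.E)
  have hι := hι.isEqualizerOf
  have hTι := hE.map_T hι
  have hTTι := hE.map_T hTι
  have := hι.mono
  have := hTι.mono
  have := hTTι.mono
  obtain ⟨lam, hlam⟩ := hTι.exists_lift (ι ≫ 𝕋.ℓ.app P.E) (by
    have h₁ := 𝕋.T_map_ℓ P.lam
    have h₂ := hι.w
    rw [Category.assoc, Category.assoc, ← h₁, reassoc_of% h₂, 𝕋.ℓ_ℓ])
  have hlam₂ : lam ≫ 𝕋.T.map lam = lam ≫ 𝕋.ℓ.app E' := by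
    have h₁ := 𝕋.T_map_ℓ ι
    have h₂ := 𝕋.ℓ_ℓ P.E
    rw [← cancel_mono (𝕋.T.map (𝕋.T.map ι)), Category.assoc, Category.assoc, ← h₁,
      ← 𝕋.T.map_comp, hlam, 𝕋.T.map_comp, reassoc_of% hlam, reassoc_of% hlam, h₂]
  obtain ⟨u, hu⟩ := hι.exists_lift P.lam P.lam_lam
  obtain ⟨M', q, ξ, hξ, hq⟩ := exists_splitting hE lam hlam₂
  refine ⟨{ E := E', M := M', q := q, ξ := ξ, lam := lam, lam_lam := hlam₂, ξ_q := hξ, q_ξ := hq },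
    ⟨u, ?_⟩, ι, hι, hlam, hu⟩
  change u ≫ lam = _
  rw [← cancel_mono (𝕋.T.map ι), Category.assoc, hlam, reassoc_of% hu, Category.assoc,
    ← 𝕋.T.map_comp, hu, P.lam_lam]

namespace IsEqualizerArrow

variable {P Q : PreDiffBundle 𝕋} {u : P ⟶ Q} {ι : Q.E ⟶ 𝕋.T.obj P.E}

/-- The lift of the equalizer is `T u ∘ ι`, so that a morphism out of `Q` is determined by its
composite with `u`. -/
theorem lam_eq (h : IsEqualizerArrow u ι) (hE : 𝕋.HasTEqualizers) : Q.lam = ι ≫ 𝕋.T.map u.f := by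
  have := (hE.map_T h.isEqualizerOf).mono
  rw [← cancel_mono (𝕋.T.map ι), h.lam_ι, Category.assoc, ← 𝕋.T.map_comp, h.u_ι,
    h.isEqualizerOf.w]

theorem mono_lam (h : IsEqualizerArrow u ι) : Mono Q.lam := by
  have := h.isEqualizerOf.mono
  have : Mono (Q.lam ≫ 𝕋.T.map ι) := by
    rw [h.lam_ι]
    infer_instance
  exact mono_of_mono _ (𝕋.T.map ι)

/-- The equalizer of `T lam` and `ℓ` is non-singular. Along `T ι` this reduces to the free lift on
`T E`, which is non-singular by the universality of `ℓ`. -/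
theorem isNonsingular (h : IsEqualizerArrow u ι) (hE : 𝕋.HasTEqualizers) : Q.IsNonsingular := by
  have := h.mono_lam
  have := h.isEqualizerOf.mono
  have := (hE.map_T h.isEqualizerOf).mono
  refine hE.isTEqualizer_iff.mpr (.of_exists_lift Q.lam_idem fun {Z} k hk => ?_)
  have hι : (Q.lam ≫ 𝕋.p.app Q.E) ≫ ι = ι ≫ 𝕋.p.app P.E ≫ 𝕋.zero.app P.E := by
    rw [Category.assoc, ← T_map_p, ← Category.assoc, h.lam_ι, Category.assoc, ℓ_p_T]
  -- The equation for `k` becomes `T (zero ∘ p) w = zero (p w)`, where `w` is the image of `k`.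
  have hw : (k ≫ 𝕋.T.map ι) ≫ 𝕋.T.map (𝕋.p.app P.E) ≫ 𝕋.T.map (𝕋.zero.app P.E) =
      (k ≫ 𝕋.T.map ι) ≫ 𝕋.p.app (𝕋.T.obj P.E) ≫ 𝕋.zero.app (𝕋.T.obj P.E) := by
    have h₁ := 𝕋.T_map_p ι
    have h₂ := 𝕋.ℓ_p_T Q.E
    rw [Category.assoc, ← 𝕋.T.map_comp, ← 𝕋.T.map_comp, ← hι, 𝕋.T.map_comp, ← reassoc_of% hk,
      reassoc_of% h₂, Category.assoc, reassoc_of% h₁, zero_T_map]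
  set w := k ≫ 𝕋.T.map ι
  have hw₁ : w ≫ 𝕋.T.map (𝕋.p.app P.E) =
      w ≫ 𝕋.p.app (𝕋.T.obj P.E) ≫ 𝕋.p.app P.E ≫ 𝕋.zero.app P.E := by
    have := congrArg (fun f => f ≫ 𝕋.T.map (𝕋.p.app P.E)) hw
    simp only [Category.assoc, ← 𝕋.T.map_comp, 𝕋.zero_p, zero_T_map] at this
    simpa using this
  have hw₂ : w ≫ 𝕋.p.app (𝕋.T.obj P.E) =
      w ≫ 𝕋.p.app (𝕋.T.obj P.E) ≫ 𝕋.p.app P.E ≫ 𝕋.zero.app P.E := by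
    have := congrArg (fun f => f ≫ 𝕋.p.app (𝕋.T.obj P.E)) hw
    simp only [Category.assoc, ← 𝕋.T.map_comp, 𝕋.zero_p, T_map_p] at this
    simpa using this.symm
  obtain ⟨y, hy⟩ := 𝕋.exists_comp_ℓ _ hw₁ hw₂
  obtain ⟨x, hx⟩ := h.isEqualizerOf.exists_lift y (by
    rw [← cancel_mono (𝕋.ℓ.app (𝕋.T.obj P.E)), Category.assoc, Category.assoc, T_map_ℓ,
      ← 𝕋.ℓ_ℓ, reassoc_of% hy, reassoc_of% hy, Category.assoc, Category.assoc, ← 𝕋.T.map_comp,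
      ← 𝕋.T.map_comp, h.isEqualizerOf.w])
  refine ⟨x, ?_⟩
  rw [← cancel_mono (𝕋.T.map ι), Category.assoc, h.lam_ι, reassoc_of% hx, hy]

/-- Every morphism `f` to a non-singular bundle `F` factors through `u`: the morphism `T f ∘ ι`
equalizes `T lam` and `ℓ` on `F`, so that it lifts along the lift of `F`. -/
theorem exists_factor (h : IsEqualizerArrow u ι) (hE : 𝕋.HasTEqualizers) {F : PreDiffBundle 𝕋}
    (hF : F.IsNonsingular) (f : P ⟶ F) : ∃ g : Q ⟶ F, u ≫ g = f := by
  have hF' := hF.isEqualizerOf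
  have := hF'.mono
  have := (hE.map_T hF').mono
  have hw := h.isEqualizerOf.w
  have hf := f.comm
  obtain ⟨g, hg⟩ := hF'.exists_lift (ι ≫ 𝕋.T.map f.f) (by
    rw [Category.assoc, ← 𝕋.T.map_comp, hf, 𝕋.T.map_comp, reassoc_of% hw, Category.assoc,
      T_map_ℓ])
  have hu : u.f ≫ g = f.f := by
    rw [← cancel_mono F.lam, Category.assoc, hg, ← Category.assoc, h.u_ι, f.comm]
  refine ⟨⟨g, ?_⟩, Hom.ext hu⟩
  rw [hg, h.lam_eq hE, Category.assoc, ← 𝕋.T.map_comp, hu]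

theorem hom_ext (h : IsEqualizerArrow u ι) (hE : 𝕋.HasTEqualizers) {F : PreDiffBundle 𝕋}
    (hF : F.IsNonsingular) {g g' : Q ⟶ F} (e : u ≫ g = u ≫ g') : g = g' := by
  have := hF.isEqualizerOf.mono
  have e' : u.f ≫ g.f = u.f ≫ g'.f := congrArg Hom.f e
  apply Hom.ext
  rw [← cancel_mono F.lam, g.comm, g'.comm, h.lam_eq hE, Category.assoc, Category.assoc,
    ← 𝕋.T.map_comp, ← 𝕋.T.map_comp, e']

theorem of_iso (h : IsEqualizerArrow u ι) {Q' : PreDiffBundle 𝕋} {u' : P ⟶ Q'} (j : Q' ≅ Q)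
    (hj : u' ≫ j.hom = u) : IsEqualizerArrow u' (j.hom.f ≫ ι) := by
  subst hj
  have h₁ : j.hom.f ≫ j.inv.f = 𝟙 _ := congrArg Hom.f j.hom_inv_id
  have h₂ : j.inv.f ≫ j.hom.f = 𝟙 _ := congrArg Hom.f j.inv_hom_id
  have := h.isEqualizerOf.mono
  have : Mono j.hom.f := ⟨fun a b e => by
    have := congrArg (· ≫ j.inv.f) e
    simpa [h₁] using this⟩
  refine ⟨.of_exists_lift ?_ fun k hk => ?_, ?_, ?_⟩
  · rw [Category.assoc, h.isEqualizerOf.w, Category.assoc]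
  · obtain ⟨l, hl⟩ := h.isEqualizerOf.exists_lift k hk
    exact ⟨l ≫ j.inv.f, by rw [Category.assoc, reassoc_of% h₂, hl]⟩
  · have := j.hom.comm
    rw [𝕋.T.map_comp, ← reassoc_of% this, h.lam_ι, Category.assoc]
  · rw [← h.u_ι]
    exact (Category.assoc _ _ _).symm

/-- The equalizer is natural in the bundle. -/
theorem naturality (h : IsEqualizerArrow u ι) (hE : 𝕋.HasTEqualizers) {P' Q' : PreDiffBundle 𝕋}
    {u' : P' ⟶ Q'} {ι' : Q'.E ⟶ 𝕋.T.obj P'.E} (h' : IsEqualizerArrow u' ι') {f : P ⟶ P'}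
    {g : Q ⟶ Q'} (e : u ≫ g = f ≫ u') : g.f ≫ ι' = ι ≫ 𝕋.T.map f.f := by
  have hw := h.isEqualizerOf.w
  have e' : u.f ≫ g.f = f.f ≫ u'.f := congrArg Hom.f e
  have hf := f.comm
  obtain ⟨k, hk⟩ := h'.isEqualizerOf.exists_lift (ι ≫ 𝕋.T.map f.f) (by
    rw [Category.assoc, ← 𝕋.T.map_comp, hf, 𝕋.T.map_comp, reassoc_of% hw, Category.assoc,
      T_map_ℓ])
  have := h'.mono_lam
  have hkg : k = g.f := by
    rw [← cancel_mono Q'.lam, g.comm, h'.lam_eq hE, reassoc_of% hk, h.lam_eq hE, Category.assoc,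
      ← 𝕋.T.map_comp, ← 𝕋.T.map_comp, e']
  rw [← hkg, hk]

end IsEqualizerArrow

end PreDiffBundle

namespace PreDiffBundle

variable {C : Type u} [Category.{v} C] {𝕋 : TangentStructure C}

open TangentStructure

/-! ### `T`-limits of pre-differential bundles -/

/-- A cone of pre-differential bundles is a limit if its cone of total spaces is a `T`-limit. -/
theorem isLimit_of_isTLimit_total {J : Type*} [Category J] {K : J ⥤ PreDiffBundle 𝕋}
    {s : Cone K} (hs : 𝕋.IsTLimit (total.mapCone s)) : Nonempty (IsLimit s) := by
  obtain ⟨h⟩ := hs.isLimit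
  obtain ⟨hT⟩ := hs.isLimit_T
  have hl (t : Cone K) (j : J) : h.lift (total.mapCone t) ≫ (s.π.app j).f = (t.π.app j).f :=
    h.fac (total.mapCone t) j
  refine ⟨⟨fun t => ⟨h.lift (total.mapCone t), ?_⟩, fun t j => Hom.ext (hl t j),
    fun t m hm => Hom.ext (h.uniq (total.mapCone t) m.f fun j => congrArg Hom.f (hm j))⟩⟩
  apply hT.hom_ext
  intro j
  have key (l : t.pt.E ⟶ s.pt.E) (hl : l ≫ (s.π.app j).f = (t.π.app j).f) :
      (l ≫ s.pt.lam) ≫ 𝕋.T.map (s.π.app j).f = (t.pt.lam ≫ 𝕋.T.map l) ≫ 𝕋.T.map (s.π.app j).f := by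
    have h₁ := (s.π.app j).comm
    have h₂ := (t.π.app j).comm
    dsimp only [Functor.const_obj_obj] at h₁ h₂ hl ⊢
    rw [Category.assoc, Category.assoc, ← h₁, ← 𝕋.T.map_comp, reassoc_of% hl, hl, h₂]
  exact key _ (hl t j)

/-- If `C` has `T`-limits of shape `J`, these lift to cones of pre-differential bundles: the lift on
the limit of the total spaces is induced by their lifts, and its idempotent splits. -/
theorem exists_isTLimit_total (hE : 𝕋.HasTEqualizers) {J : Type*} [Category J]
    (hJ : 𝕋.HasTLimitsOfShape J) (K : J ⥤ PreDiffBundle 𝕋) :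
    ∃ s : Cone K, 𝕋.IsTLimit (total.mapCone s) := by
  have := hJ.hasLimits
  have hL := hJ.isTLimit (limit.isLimit (K ⋙ total))
  obtain ⟨hT⟩ := hL.isLimit_T
  obtain ⟨hTT⟩ := hL.map_T.isLimit_T
  let π (j : J) : limit (K ⋙ total) ⟶ (K.obj j).E := limit.π (K ⋙ total) j
  have hπ {i j : J} (f : i ⟶ j) : π i ≫ (K.map f).f = π j := limit.w (K ⋙ total) f
  let c : Cone ((K ⋙ total) ⋙ 𝕋.T) :=
    { pt := limit (K ⋙ total)
      π :=
        { app j := π j ≫ (K.obj j).lam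
          naturality i j f := by
            change 𝟙 _ ≫ π j ≫ (K.obj j).lam = (π i ≫ (K.obj i).lam) ≫ 𝕋.T.map (K.map f).f
            rw [Category.id_comp, Category.assoc, ← (K.map f).comm, reassoc_of% (hπ f)] } }
  let lam : limit (K ⋙ total) ⟶ 𝕋.T.obj (limit (K ⋙ total)) := hT.lift c
  have hlam (j : J) : lam ≫ 𝕋.T.map (π j) = π j ≫ (K.obj j).lam := hT.fac c j
  have lam_lam : lam ≫ 𝕋.T.map lam = lam ≫ 𝕋.ℓ.app _ := by
    apply hTT.hom_ext
    intro j
    change (lam ≫ 𝕋.T.map lam) ≫ 𝕋.T.map (𝕋.T.map (π j)) =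
      (lam ≫ 𝕋.ℓ.app _) ≫ 𝕋.T.map (𝕋.T.map (π j))
    rw [Category.assoc, Category.assoc, ← 𝕋.T.map_comp, hlam, 𝕋.T.map_comp,
      reassoc_of% (hlam j), (K.obj j).lam_lam, ← T_map_ℓ, reassoc_of% (hlam j)]
  obtain ⟨M, q, ξ, h₁, h₂⟩ := exists_splitting hE lam lam_lam
  exact ⟨
    { pt := { E := limit (K ⋙ total), M := M, q := q, ξ := ξ, lam := lam, lam_lam := lam_lam,
              ξ_q := h₁, q_ξ := h₂ }
      π :=
        { app j := ⟨π j, (hlam j).symm⟩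
          naturality i j f := Hom.ext ((Category.id_comp _).trans (hπ f).symm) } }, hL⟩

/-- If `C` has `T`-limits of shape `J`, limits of pre-differential bundles of this shape are computed
as `T`-limits of total spaces. -/
theorem isTLimit_total_of_isLimit (hE : 𝕋.HasTEqualizers) {J : Type*} [Category J]
    (hJ : 𝕋.HasTLimitsOfShape J) {K : J ⥤ PreDiffBundle 𝕋} {s : Cone K} (hs : IsLimit s) :
    𝕋.IsTLimit (total.mapCone s) := by
  obtain ⟨t, ht⟩ := exists_isTLimit_total hE hJ K
  obtain ⟨h⟩ := isLimit_of_isTLimit_total ht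
  have e : total.mapCone t ≅ total.mapCone s :=
    (Cone.functoriality K total).mapIso (h.uniqueUpToIso hs)
  exact hJ.isTLimit (ht.isLimit.some.ofIsoLimit e)

/-! ### The reflection -/

theorem exists_reflective (hE : 𝕋.HasTEqualizers) (hP : 𝕋.HasTPullbacks) :
    Nonempty (Reflective (DiffBundle.incl 𝕋)) := by
  choose Q u ι h using exists_isEqualizerArrow (𝕋 := 𝕋) hE
  let R (P : PreDiffBundle 𝕋) : DiffBundle 𝕋 :=
    ⟨Q P, (isDiffBundle_iff hP _).mpr ((h P).isNonsingular hE)⟩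
  have bij (P : PreDiffBundle 𝕋) (D : DiffBundle 𝕋) :
      Function.Bijective fun g : R P ⟶ D => u P ≫ g.hom := by
    have hD := (isDiffBundle_iff hP _).mp D.property
    refine ⟨fun g g' e => ObjectProperty.hom_ext _ ((h P).hom_ext hE hD e), fun f => ?_⟩
    obtain ⟨g, hg⟩ := (h P).exists_factor hE hD f
    exact ⟨ObjectProperty.homMk g, hg⟩
  exact ⟨{ L := _
           adj := Adjunction.adjunctionOfEquivLeft (G := DiffBundle.incl 𝕋)
            (fun P D => Equiv.ofBijective _ (bij P D))
            fun P D D' g k => (Category.assoc (u P) k.hom g.hom).symm }⟩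

section

variable {X : Type*} [Category* X] (Φ : X ⥤ PreDiffBundle 𝕋) [Φ.IsEquivalence]
  (I : DiffBundle 𝕋 ⥤ X) [Reflective I] (α : I ⋙ Φ ≅ DiffBundle.incl 𝕋)

include α in
/-- Any choice of a reflector is given by the equalizer of `T lam` and `ℓ`, since the unit has the
same universal property as the morphism to that equalizer. -/
theorem exists_isEqualizerArrow_unit (hE : 𝕋.HasTEqualizers) (hP : 𝕋.HasTPullbacks) (P : X) :
    ∃ ι, IsEqualizerArrow (Q := Φ.obj (I.obj ((reflector I).obj P)))
      (Φ.map ((reflectorAdjunction I).unit.app P)) ι := by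
  obtain ⟨Q, u, ι, h⟩ := exists_isEqualizerArrow hE (Φ.obj P)
  have hQ := h.isNonsingular hE
  let D : DiffBundle 𝕋 := ⟨Q, (isDiffBundle_iff hP _).mpr hQ⟩
  let a (B : DiffBundle 𝕋) : Φ.obj (I.obj B) ≅ B.obj := α.app B
  let e : Φ.obj (I.obj ((reflector I).obj P)) ≅ ((reflector I).obj P).obj := α.app _
  let ηP : Φ.obj P ⟶ Φ.obj (I.obj ((reflector I).obj P)) :=
    Φ.map ((reflectorAdjunction I).unit.app P)
  -- The unit is universal among the morphisms to differential bundles.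
  have uni_exists (B : DiffBundle 𝕋) (f : Φ.obj P ⟶ B.obj) : ∃ g, ηP ≫ g = f := by
    obtain ⟨f', hf'⟩ := Φ.map_surjective (f ≫ (a B).inv)
    refine ⟨Φ.map (I.map (((reflectorAdjunction I).homEquiv _ _).symm f')) ≫ (a B).hom, ?_⟩
    have : (reflectorAdjunction I).unit.app P ≫
        I.map (((reflectorAdjunction I).homEquiv _ _).symm f') = f' := by
      have h := (reflectorAdjunction I).homEquiv_unit
        (f := ((reflectorAdjunction I).homEquiv P B).symm f')
      rw [Equiv.apply_symm_apply] at h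
      exact h.symm
    rw [← Category.assoc, ← Φ.map_comp, this, hf', Category.assoc, Iso.inv_hom_id,
      Category.comp_id]
  have uni_ext (B : DiffBundle 𝕋) (g g' : Φ.obj (I.obj ((reflector I).obj P)) ⟶ Φ.obj (I.obj B))
      (hg : ηP ≫ g = ηP ≫ g') : g = g' := by
    obtain ⟨k, rfl⟩ := Φ.map_surjective g
    obtain ⟨k', rfl⟩ := Φ.map_surjective g'
    obtain ⟨k, rfl⟩ := I.map_surjective k
    obtain ⟨k', rfl⟩ := I.map_surjective k'
    rw [← Φ.map_comp, ← Φ.map_comp] at hg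
    have := Φ.map_injective hg
    rw [← Adjunction.homEquiv_unit, ← Adjunction.homEquiv_unit] at this
    rw [((reflectorAdjunction I).homEquiv _ _).injective this]
  obtain ⟨k, hk⟩ := uni_exists D u
  obtain ⟨m, hm⟩ := h.exists_factor hE ((isDiffBundle_iff hP _).mp ((reflector I).obj P).property)
    (ηP ≫ e.hom)
  refine ⟨_, h.of_iso ⟨k, m ≫ e.inv, ?_, ?_⟩ hk⟩
  · apply uni_ext
    rw [reassoc_of% hk, reassoc_of% hm]
    simp
  · apply h.hom_ext hE hQ
    rw [Category.assoc, reassoc_of% hm]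
    simpa using hk

theorem isDiffBundle_of_iso (hE : 𝕋.HasTEqualizers) (hP : 𝕋.HasTPullbacks)
    {P Q : PreDiffBundle 𝕋} (e : P ≅ Q) (h : IsDiffBundle 𝕋 Q) : IsDiffBundle 𝕋 P := by
  have hQ := (isDiffBundle_iff hP _).mp h
  have h' : IsEqualizerArrow (𝟙 Q) Q.lam := ⟨hQ.isEqualizerOf, Q.lam_lam, Category.id_comp _⟩
  exact (isDiffBundle_iff hP _).mpr
    ((h'.of_iso (u' := e.inv) e e.inv_hom_id).isNonsingular hE)

/-- An algebra structure is a retraction of the unit; for a reflective subcategory it exists only if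
the unit is invertible, and then its inverse is one. -/
theorem nonempty_algebra_iff (P : X) :
    Nonempty {A : (reflectorAdjunction I).toMonad.Algebra // A.A = P} ↔ I.essImage P := by
  constructor
  · rintro ⟨A, rfl⟩
    have : IsSplitMono ((reflectorAdjunction I).unit.app A.A) := ⟨⟨A.a, A.unit⟩⟩
    exact mem_essImage_of_unit_isSplitMono
  · intro h
    have := h.unit_isIso
    let T := (reflectorAdjunction I).toMonad
    have hη : IsIso (T.η.app P) := this
    refine ⟨⟨P, inv (T.η.app P), IsIso.hom_inv_id _, ?_⟩, rfl⟩
    have e : T.μ.app P = T.map (inv (T.η.app P)) := by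
      rw [Functor.map_inv]
      exact IsIso.eq_inv_of_hom_inv_id (T.right_unit P)
    rw [e]

omit [Reflective I] in
include α in
theorem essImage_iff (hE : 𝕋.HasTEqualizers) (hP : 𝕋.HasTPullbacks) (P : X) :
    I.essImage P ↔ IsDiffBundle 𝕋 (Φ.obj P) := by
  constructor
  · rintro ⟨D, ⟨e⟩⟩
    exact isDiffBundle_of_iso hE hP (Φ.mapIso e.symm ≪≫ α.app D) D.property
  · intro h
    let D : DiffBundle 𝕋 := ⟨Φ.obj P, h⟩
    exact ⟨D, ⟨Φ.preimageIso (α.app D)⟩⟩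

include α in
/-- The reflection preserves `T`-limits of total spaces, since these commute with the equalizer of
`T lam` and `ℓ`. -/
theorem isTLimit_total_reflector (hE : 𝕋.HasTEqualizers) (hP : 𝕋.HasTPullbacks)
    {J : Type*} [Category J] {K : J ⥤ X} (s : Cone K)
    (hs : 𝕋.IsTLimit ((Φ ⋙ total).mapCone s)) :
    𝕋.IsTLimit ((Φ ⋙ total).mapCone ((reflector I ⋙ I).mapCone s)) := by
  choose ι h using exists_isEqualizerArrow_unit Φ I α hE hP
  have nat {P Q : X} (f : P ⟶ Q) : (Φ.map (I.map ((reflector I).map f))).f ≫ ι Q =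
      ι P ≫ 𝕋.T.map (Φ.map f).f := by
    refine (h P).naturality hE (h Q) ?_
    rw [← Φ.map_comp, ← Φ.map_comp]
    exact congrArg Φ.map ((reflectorAdjunction I).unit.naturality f).symm
  let F : X ⥤ C := Φ ⋙ total
  let G : X ⥤ C := (reflector I ⋙ I) ⋙ Φ ⋙ total
  let ν : G ⟶ F ⋙ 𝕋.T := { app P := ι P, naturality _ _ f := nat f }
  let β : F ⋙ 𝕋.T ⟶ (F ⋙ 𝕋.T) ⋙ 𝕋.T :=
    { app P := 𝕋.T.map (Φ.obj P).lam
      naturality P Q f := by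
        change 𝕋.T.map (Φ.map f).f ≫ 𝕋.T.map (Φ.obj Q).lam =
          𝕋.T.map (Φ.obj P).lam ≫ 𝕋.T.map (𝕋.T.map (Φ.map f).f)
        rw [← 𝕋.T.map_comp, (Φ.map f).comm, 𝕋.T.map_comp] }
  let γ : F ⋙ 𝕋.T ⟶ (F ⋙ 𝕋.T) ⋙ 𝕋.T := Functor.whiskerLeft F 𝕋.ℓ
  have hν (P : X) : IsEqualizerOf (ν.app P) (β.app P) (γ.app P) := (h P).isEqualizerOf
  have hs' := hs.map_T
  have hs'' := hs'.map_T
  intro n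
  have := hE.hasTLimitsOfShape.preserves n
  let N := 𝕋.iter n
  refine IsEqualizerOf.isLimit_cone (a := (G ⋙ N).mapCone s) (b := ((F ⋙ 𝕋.T) ⋙ N).mapCone s)
    (d := (((F ⋙ 𝕋.T) ⋙ 𝕋.T) ⋙ N).mapCone s)
    (ι := Functor.whiskerLeft K (Functor.whiskerRight ν N))
    (f := Functor.whiskerLeft K (Functor.whiskerRight β N))
    (g := Functor.whiskerLeft K (Functor.whiskerRight γ N))
    (fun j => (hν _).map N) ((hν s.pt).map N) (fun j => ?_) (fun j => ?_) (fun j => ?_)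
    (hs' n).some (hs'' n).some
  · exact ((Functor.whiskerRight ν N).naturality (s.π.app j)).symm
  · exact ((Functor.whiskerRight β N).naturality (s.π.app j)).symm
  · exact ((Functor.whiskerRight γ N).naturality (s.π.app j)).symm

include α in
theorem preservesLimitsOfShape_reflector (hE : 𝕋.HasTEqualizers) (hP : 𝕋.HasTPullbacks)
    {J : Type*} [Category J] (hJ : 𝕋.HasTLimitsOfShape J) :
    PreservesLimitsOfShape J (reflector I ⋙ I) where
  preservesLimit := ⟨fun {s} hs => by
    have h₁ := isTLimit_total_of_isLimit hE hJ (isLimitOfPreserves Φ hs)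
    have h₂ := isTLimit_total_reflector Φ I α hE hP s h₁
    have h₃ := isLimit_of_isTLimit_total
      (s := Φ.mapCone ((reflector I ⋙ I).mapCone s)) h₂
    exact ⟨isLimitOfReflects Φ h₃.some⟩⟩

include α in
/-- The description of the reflection is independent of the chosen reflector and of the category `X`
equivalent to the category of pre-differential bundles. -/
theorem isEqualizerReflection (hE : 𝕋.HasTEqualizers) (hP : 𝕋.HasTPullbacks) :
    IsEqualizerReflection Φ I where
  equalizer P := by
    obtain ⟨ι, h⟩ := exists_isEqualizerArrow_unit Φ I α hE hP P
    exact ⟨ι, hE.isTEqualizer_iff.mpr h.isEqualizerOf, h.lam_ι, h.u_ι⟩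
  idempotent := inferInstance
  algebras := (monadicOfReflective (R := I)).eqv
  algebra_iff P := (nonempty_algebra_iff I P).trans (essImage_iff Φ I α hE hP P)
  preserves_T_limits s hs := isTLimit_total_reflector Φ I α hE hP s hs
  preserves_pullbacks := preservesLimitsOfShape_reflector Φ I α hE hP hP.hasTLimitsOfShape
  preserves_equalizers := preservesLimitsOfShape_reflector Φ I α hE hP hE.hasTLimitsOfShape
  -- `C` need not have a terminal object, but any reflector preserves terminal objects.
  preserves_terminal := by
    have : PreservesLimitsOfShape (Discrete.{0} PEmpty.{1}) (reflector I) :=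
      leftAdjoint_preservesTerminal_of_reflective I
    have : PreservesLimitsOfSize.{0, 0} I := (reflectorAdjunction I).rightAdjoint_preservesLimits
    infer_instance

end

end PreDiffBundle

/-! ### Isomorphisms of categories -/

/-- A fully faithful functor that is bijective on objects is an isomorphism of categories. -/
theorem exists_inverse_of_fullyFaithful {A : Type*} [Category* A] {B : Type*} [Category* B]
    (F : A ⥤ B) [F.Full] [F.Faithful] (g : B → A) (h₁ : ∀ b, F.obj (g b) = b)
    (h₂ : ∀ a, g (F.obj a) = a) : ∃ G : B ⥤ A, F ⋙ G = 𝟭 A ∧ G ⋙ F = 𝟭 B := by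
  let G : B ⥤ A :=
    { obj := g
      map {b c} f := F.preimage (eqToHom (h₁ b) ≫ f ≫ eqToHom (h₁ c).symm)
      map_id b := F.map_injective (by simp)
      map_comp f f' := F.map_injective (by simp) }
  have hG {b c : B} (f : b ⟶ c) :
      F.map (G.map f) = eqToHom (h₁ b) ≫ f ≫ eqToHom (h₁ c).symm := F.map_preimage _
  refine ⟨G, CategoryTheory.Functor.ext h₂ fun a b f => F.map_injective ?_,
    CategoryTheory.Functor.ext h₁ fun b c f => hG f⟩
  change F.map (G.map (F.map f)) = _
  rw [hG]
  simp [eqToHom_map]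

namespace LambdaFunctors

open LambdaPlus WeilEnrichment

variable {C : Type u} [Category.{v} C] [MonoidalLeftAction Weil1 C] [IsTangentAction C]

/-! ### Enriched functors on `Λ⁺` from pre-differential bundles -/

/-- The morphism of Weil spaces that is constant at the morphism `f`. -/
noncomputable def const {A B : C} (X : WeilSpace.{v}) (f : A ⟶ B) : X ⟶ WeilEnrichment.hom A B :=
  WeilSpace.ofFun (fun V _ => f ≫ idFun V B) fun k _ => by
    rw [idFun_naturality k, ← Category.assoc]
    rfl

theorem point_const {A B : C} (f : A ⟶ B) : point (const _ f) = f := by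
  change (f ≫ idFun (𝟙_ Weil1) B) ≫ (λₗ B).hom = f
  rw [Category.assoc, idFun_unit, Category.comp_id]

omit [IsTangentAction C] in
theorem compFun_const {A B D : C} (f : A ⟶ B) (g : B ⟶ D) (V : Weil1) :
    compFun (f ≫ idFun V B) (g ≫ idFun V D) = (f ≫ g) ≫ idFun V D := by
  rw [comp_idFun_compFun, Category.assoc]

omit [IsTangentAction C] in
/-- A lift, in terms of the action of `W`, is an action of the multiplicative semigroup `D`. -/
theorem compFun_lift {E : C} {l : E ⟶ Weil1.W ⊙ₗ E}
    (hl : l ≫ Weil1.W ⊴ₗ l = l ≫ Weil1.liftW ⊵ₗ E ≫ (αₗ Weil1.W Weil1.W E).hom)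
    {V : Weil1} (f g : Weil1.W ⟶ V) :
    compFun (l ≫ f ⊵ₗ E) (l ≫ g ⊵ₗ E) = l ≫ mulD f g ⊵ₗ E := by
  have h := compFun_naturality (Weil1.desc f g) (l ≫ Weil1.inl Weil1.W Weil1.W ⊵ₗ E)
    (l ≫ Weil1.inr Weil1.W Weil1.W ⊵ₗ E)
  have h₁ : (l ≫ Weil1.inl Weil1.W Weil1.W ⊵ₗ E) ≫ Weil1.desc f g ⊵ₗ E = l ≫ f ⊵ₗ E := by
    rw [Category.assoc, ← comp_actionHomLeft, Weil1.inl_desc]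
  have h₂ : (l ≫ Weil1.inr Weil1.W Weil1.W ⊵ₗ E) ≫ Weil1.desc f g ⊵ₗ E = l ≫ g ⊵ₗ E := by
    rw [Category.assoc, ← comp_actionHomLeft, Weil1.inr_desc]
  rw [h₁, h₂] at h
  refine h.trans ?_
  have h₃ : compFun (l ≫ Weil1.inl Weil1.W Weil1.W ⊵ₗ E) (l ≫ Weil1.inr Weil1.W Weil1.W ⊵ₗ E) =
      l ≫ Weil1.liftW ⊵ₗ E := by
    refine (compFun_inl_inr l l).trans ?_
    rw [reassoc_of% hl, Iso.hom_inv_id, Category.comp_id]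
  rw [h₃, Category.assoc, ← comp_actionHomLeft]
  rfl

/-- The structure of a pre-differential bundle with total space `o total` and base `o base`, in terms
of the action of the Weil algebras. The family `o` is a parameter, so that enriched functors with the
object map `o` correspond to such data without any transport along equalities of objects. -/
structure BundleData (o : LambdaPlus → C) where
  q : o total ⟶ o base
  ξ : o base ⟶ o total
  l : o total ⟶ Weil1.W ⊙ₗ o total
  lift_lift : l ≫ Weil1.W ⊴ₗ l = l ≫ Weil1.liftW ⊵ₗ _ ≫ (αₗ Weil1.W Weil1.W _).hom
  sec_proj : ξ ≫ q = 𝟙 _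
  proj_sec : q ≫ ξ = l ≫ Weil1.aug 1 ⊵ₗ _ ≫ (λₗ _).hom

namespace BundleData

variable {o : LambdaPlus → C} (d : BundleData o)

omit [IsTangentAction C] in
theorem l_zeroD (V : Weil1) : d.l ≫ zeroD V ⊵ₗ _ = (d.q ≫ d.ξ) ≫ idFun V _ := by
  rw [d.proj_sec, zeroD, comp_actionHomLeft, idFun]
  simp

omit [IsTangentAction C] in
/-- The projection is invariant under `D`: as `f · 0 = 0` in `D`, this holds after composition with
the section. -/
theorem compFun_proj {V : Weil1} (f : Weil1.W ⟶ V) :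
    compFun (d.l ≫ f ⊵ₗ _) (d.q ≫ idFun V _) = d.q ≫ idFun V _ := by
  have e : mulD f (zeroD V) = zeroD V :=
    W_hom_ext (by rw [mulD_val, zeroD_val, MulZeroClass.mul_zero])
  have h := compFun_lift d.lift_lift f (zeroD V)
  rw [e, l_zeroD] at h
  have h' := congrArg (fun k => compFun k (d.q ≫ idFun V _)) h
  have e' : compFun ((d.q ≫ d.ξ) ≫ idFun V _) (d.q ≫ idFun V _) = d.q ≫ idFun V _ := by
    rw [compFun_const, Category.assoc d.q, d.sec_proj, Category.comp_id]
  rwa [compFun_assoc, e'] at h'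

omit [IsTangentAction C] in
/-- The section is invariant under `D`: as `0 · f = 0` in `D`, this holds after composition with the
projection. -/
theorem compFun_sec {V : Weil1} (f : Weil1.W ⟶ V) :
    compFun (d.ξ ≫ idFun V _) (d.l ≫ f ⊵ₗ _) = d.ξ ≫ idFun V _ := by
  have e : mulD (zeroD V) f = zeroD V :=
    W_hom_ext (by rw [mulD_val, zeroD_val, MulZeroClass.zero_mul])
  have h := compFun_lift d.lift_lift (zeroD V) f
  have hs := d.sec_proj
  rw [e, l_zeroD, comp_idFun_compFun] at h
  have h' := congrArg (fun k => d.ξ ≫ k) h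
  simp only [Category.assoc, reassoc_of% hs] at h'
  rw [comp_idFun_compFun, h']

/-- The action of `D + 1` on the total space. -/
noncomputable def endoMap : LambdaPlus.endo.{v} ⟶ WeilEnrichment.hom (o total) (o total) :=
  WeilSpace.ofFun (fun V (a : Endo.{v} V) =>
    Sum.elim (fun f => d.l ≫ f.down ⊵ₗ o total) (fun _ => idFun V (o total)) a) fun {U V} k a => by
      obtain f | f := a
      · change d.l ≫ (f.down ≫ k) ⊵ₗ _ = (d.l ≫ f.down ⊵ₗ _) ≫ k ⊵ₗ _
        rw [comp_actionHomLeft, Category.assoc]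
      · exact idFun_naturality k (o total)

/-- The maps on hom-objects of the enriched functor with the given data. -/
noncomputable def map : ∀ X Y : LambdaPlus, LambdaPlus.hom.{v} X Y ⟶ WeilEnrichment.hom (o X) (o Y)
  | total, total => d.endoMap
  | total, base => const _ d.q
  | base, total => const _ d.ξ
  | base, base => const _ (𝟙 _)

/-- The enriched functor with the given data. -/
noncomputable def functor : LambdaFunctors C where
  toEnrichedFunctor :=
    { obj := o
      map := d.map
      map_id
        | total => WeilSpace.hom_ext fun V _ => rfl
        | base => WeilSpace.hom_ext fun V _ => Category.id_comp _
      map_comp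
        | total, total, total => WeilSpace.hom_ext fun V a => by
          obtain ⟨f | f, g | g⟩ := a
          · exact (compFun_lift d.lift_lift f.down g.down).symm
          · exact (compFun_idFun (d.l ≫ f.down ⊵ₗ _)).symm
          · exact (idFun_compFun (d.l ≫ g.down ⊵ₗ _)).symm
          · exact (idFun_compFun (idFun V _)).symm
        | total, total, base => WeilSpace.hom_ext fun V a => by
          obtain ⟨f | f, g⟩ := a
          · exact (d.compFun_proj f.down).symm
          · exact (idFun_compFun (d.q ≫ idFun V _)).symm
        | base, total, total => WeilSpace.hom_ext fun V a => by
          obtain ⟨g, f | f⟩ := a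
          · exact (d.compFun_sec f.down).symm
          · exact (compFun_idFun (d.ξ ≫ idFun V _)).symm
        | total, base, total => WeilSpace.hom_ext fun V a =>
          (d.l_zeroD V).trans (compFun_const d.q d.ξ V).symm
        | base, total, base => WeilSpace.hom_ext fun V a => by
          refine Eq.trans ?_ (compFun_const d.ξ d.q V).symm
          rw [d.sec_proj]
          rfl
        | base, base, total => WeilSpace.hom_ext fun V a => by
          refine Eq.trans ?_ (compFun_const (𝟙 _) d.ξ V).symm
          rw [Category.id_comp]
          rfl
        | total, base, base => WeilSpace.hom_ext fun V a => by
          refine Eq.trans ?_ (compFun_const d.q (𝟙 _) V).symm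
          rw [Category.comp_id]
          rfl
        | base, base, base => WeilSpace.hom_ext fun V a => by
          refine Eq.trans ?_ (compFun_const (𝟙 _) (𝟙 _) V).symm
          rw [Category.comp_id]
          rfl }

theorem functor_congr {o' : LambdaPlus → C} {d : BundleData o} {d' : BundleData o'} (h : o = o')
    (hq : d.q ≍ d'.q) (hξ : d.ξ ≍ d'.ξ) (hl : d.l ≍ d'.l) : d.functor = d'.functor := by
  subst h
  obtain ⟨q, ξ, l, _, _, _⟩ := d
  obtain ⟨q', ξ', l', _, _, _⟩ := d'
  obtain rfl := eq_of_heq hq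
  obtain rfl := eq_of_heq hξ
  obtain rfl := eq_of_heq hl
  rfl

end BundleData

/-- The bundle data of an enriched functor on `Λ⁺`. -/
noncomputable def bundleData (F : LambdaFunctors C) : BundleData F.toEnrichedFunctor.obj where
  q := proj F
  ξ := sec F
  l := lift F
  lift_lift := lift_lift F
  sec_proj := sec_proj F
  proj_sec := proj_sec F

/-- An enriched functor on `Λ⁺` is determined by its bundle data: its values on `D` are determined by
the lift, by the Yoneda lemma, and the other hom-objects are terminal. -/
theorem functor_bundleData (F : LambdaFunctors C) : F.bundleData.functor = F := by
  have key : F.bundleData.map = F.toEnrichedFunctor.map := by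
    funext X Y
    cases X <;> cases Y <;> refine WeilSpace.hom_ext fun V a => ?_
    · exact (Category.id_comp _).trans (map_idFun F base V).symm
    · exact (val_point (F.toEnrichedFunctor.map base total) V).symm
    · exact (val_point (F.toEnrichedFunctor.map total base) V).symm
    · obtain f | f := a
      · exact (map_inl F f.down).symm
      · exact (map_idFun F total V).symm
  obtain ⟨⟨o, m, _, _⟩⟩ := F
  have : ∀ (F' : LambdaFunctors C) (h : F'.toEnrichedFunctor.obj = o),
      F'.toEnrichedFunctor.map ≍ m → F' = ⟨⟨o, m, ‹_›, ‹_›⟩⟩ := by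
    rintro ⟨⟨o', m', _, _⟩⟩ h h'
    obtain rfl : o' = o := h
    obtain rfl : m' = m := eq_of_heq h'
    rfl
  exact this _ rfl (heq_of_eq key)

variable {𝕋 : TangentStructure C} (θ : WeilPresentation 𝕋)

/-- The bundle data of a pre-differential bundle. -/
noncomputable def ofPreData (P : PreDiffBundle 𝕋) :
    BundleData (C := C) fun X => match X with | base => P.M | total => P.E where
  q := P.q
  ξ := P.ξ
  l := P.lam ≫ (θ.θ P.E).inv
  lift_lift := by
    have h := P.lam_lam
    have hℓ := θ.ℓ_eq P.E
    have hn := θ.naturality P.lam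
    rw [← cancel_mono (Weil1.W ⊴ₗ (θ.θ P.E).hom ≫ (θ.θ (𝕋.T.obj P.E)).hom)]
    simp only [Category.assoc]
    rw [← hℓ, ← actionHomRight_comp_assoc]
    simp only [Category.assoc, Iso.inv_hom_id, Iso.inv_hom_id_assoc, Category.comp_id]
    rw [hn, Iso.inv_hom_id_assoc, h]
  sec_proj := P.ξ_q
  proj_sec := by
    have h := θ.p_eq P.E
    rw [Category.assoc, ← h, Iso.inv_hom_id_assoc]
    exact P.q_ξ

theorem functor_ofPreData_toPreObj (F : LambdaFunctors C) :
    (ofPreData θ (toPreObj θ F)).functor = F := by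
  refine Eq.trans (BundleData.functor_congr ?_ ?_ ?_ ?_) F.functor_bundleData
  · funext X
    cases X <;> rfl
  · exact HEq.rfl
  · exact HEq.rfl
  · refine heq_of_eq ?_
    change (lift F ≫ (θ.θ _).hom) ≫ (θ.θ _).inv = lift F
    rw [Category.assoc, Iso.hom_inv_id, Category.comp_id]

theorem toPreObj_functor_ofPreData (P : PreDiffBundle 𝕋) :
    toPreObj θ (ofPreData θ P).functor = P := by
  have h₁ : proj (ofPreData θ P).functor = P.q := point_const P.q
  have h₂ : sec (ofPreData θ P).functor = P.ξ := point_const P.ξ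
  have h₃ : lift (ofPreData θ P).functor ≫ (θ.θ P.E).hom = P.lam := by
    change ((P.lam ≫ (θ.θ P.E).inv) ≫ 𝟙 Weil1.W ⊵ₗ P.E) ≫ (θ.θ P.E).hom = P.lam
    simp
  have ext {P Q : PreDiffBundle 𝕋} (h : P.toPreBundleData = Q.toPreBundleData) : P = Q := by
    cases P
    cases Q
    cases h
    rfl
  apply ext
  change (⟨P.E, P.M, proj (ofPreData θ P).functor, sec (ofPreData θ P).functor,
    lift (ofPreData θ P).functor ≫ (θ.θ P.E).hom⟩ : PreBundleData 𝕋) = ⟨P.E, P.M, P.q, P.ξ, P.lam⟩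
  exact congr (congr (congrArg _ h₁) h₂) h₃

/-! ### Natural transformations -/

theorem hom_ext_point {A B : C} {f g : 𝟙_ WeilSpace.{v} ⟶ WeilEnrichment.hom A B}
    (h : point f = point g) : f = g :=
  WeilSpace.hom_ext fun V _ => (val_point f V).trans (by rw [h]; exact (val_point g V).symm)

/-- Naturality at the section, which determines the component at the base. -/
theorem sec_mapTotal {F G : LambdaFunctors C} (α : F ⟶ G) :
    sec F ≫ mapTotal α = point (α.app base) ≫ sec G := by
  have h : compFun (WeilSpace.val (F.toEnrichedFunctor.map base total) (𝟙_ Weil1) PUnit.unit)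
      (WeilSpace.val (α.app total) (𝟙_ Weil1) PUnit.unit) =
      compFun (WeilSpace.val (α.app base) (𝟙_ Weil1) PUnit.unit)
        (WeilSpace.val (G.toEnrichedFunctor.map base total) (𝟙_ Weil1) PUnit.unit) :=
    WeilSpace.val_congr (α.naturality base total) (𝟙_ Weil1) PUnit.unit
  have h' := congrArg (fun k => k ≫ (λₗ _).hom) h
  exact (point_comp _ _).symm.trans (h'.trans (point_comp _ _))

/-- A natural transformation is determined by its component at the total space. -/
theorem natTrans_ext {F G : LambdaFunctors C} {α β : F ⟶ G} (h : mapTotal α = mapTotal β) :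
    α = β := by
  refine VFunctor.NatTrans.ext (funext fun X => hom_ext_point ?_)
  cases X
  · have hα := congrArg (· ≫ proj G) (sec_mapTotal α)
    have hβ := congrArg (· ≫ proj G) (sec_mapTotal β)
    simp only [Category.assoc, sec_proj, Category.comp_id] at hα hβ
    rw [← hα, ← hβ, h]
  · exact h

/-- Every morphism of lifts `f` is the component at the total space of a natural transformation, with
the component at the base `q ∘ f ∘ ξ`. -/
theorem exists_mapTotal_eq {F G : LambdaFunctors C}
    (f : F.toEnrichedFunctor.obj total ⟶ G.toEnrichedFunctor.obj total)
    (hf : f ≫ lift G = lift F ≫ Weil1.W ⊴ₗ f) : ∃ α : F ⟶ G, mapTotal α = f := by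
  have he : (proj F ≫ sec F) ≫ f = f ≫ proj G ≫ sec G := by
    have h := action_exchange (Weil1.aug 1) f
    have h' := actionUnitIso_hom_naturality (C := Weil1) f
    rw [proj_sec, proj_sec, reassoc_of% hf, Category.assoc, Category.assoc, reassoc_of% h, h']
  have hs : sec F ≫ f = (sec F ≫ f ≫ proj G) ≫ sec G := by
    have h := congrArg (fun k => sec F ≫ k) he
    have hF := sec_proj F
    simp only [Category.assoc, reassoc_of% hF] at h
    simpa using h
  have hp : proj F ≫ sec F ≫ f ≫ proj G = f ≫ proj G := by
    have h := congrArg (fun k => k ≫ proj G) he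
    simpa [sec_proj] using h
  let app : ∀ X : LambdaPlus, 𝟙_ WeilSpace.{v} ⟶
      WeilEnrichment.hom (F.toEnrichedFunctor.obj X) (G.toEnrichedFunctor.obj X)
    | total => const _ f
    | base => const _ (sec F ≫ f ≫ proj G)
  have key (X Y : LambdaPlus) (V : Weil1) (a : (LambdaPlus.hom.{v} X Y).obj.obj V) :
      compFun (WeilSpace.val (F.toEnrichedFunctor.map X Y) V a)
        (WeilSpace.val (app Y) V PUnit.unit) =
      compFun (WeilSpace.val (app X) V PUnit.unit)
        (WeilSpace.val (G.toEnrichedFunctor.map X Y) V a) := by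
    cases X <;> cases Y
    · have e (H : LambdaFunctors C) : WeilSpace.val (H.toEnrichedFunctor.map base base) V a =
        idFun V _ := map_idFun H base V
      rw [e, e]
      exact (idFun_compFun (WeilSpace.val (app base) V PUnit.unit)).trans
        (compFun_idFun (WeilSpace.val (app base) V PUnit.unit)).symm
    · have e (H : LambdaFunctors C) : WeilSpace.val (H.toEnrichedFunctor.map base total) V a =
        sec H ≫ idFun V _ := val_point (H.toEnrichedFunctor.map base total) V
      rw [e, e]
      refine (compFun_const (sec F) f V).trans (Eq.trans ?_ (compFun_const _ (sec G) V).symm)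
      rw [hs]
    · have e (H : LambdaFunctors C) : WeilSpace.val (H.toEnrichedFunctor.map total base) V a =
        proj H ≫ idFun V _ := val_point (H.toEnrichedFunctor.map total base) V
      rw [e, e]
      refine (compFun_const (proj F) _ V).trans (Eq.trans ?_ (compFun_const f (proj G) V).symm)
      rw [hp]
    · obtain k | k := a
      · have e (H : LambdaFunctors C) : WeilSpace.val (H.toEnrichedFunctor.map total total) V
          (Sum.inl k : Endo.{v} V) = lift H ≫ k.down ⊵ₗ _ := map_inl H k.down
        refine (congrArg (fun t => compFun t (f ≫ idFun V _)) (e F)).trans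
          (Eq.trans ?_ (congrArg (fun t => compFun (f ≫ idFun V _) t) (e G)).symm)
        rw [compFun_comp_idFun, comp_idFun_compFun, reassoc_of% hf, Category.assoc,
          action_exchange]
      · have e (H : LambdaFunctors C) : WeilSpace.val (H.toEnrichedFunctor.map total total) V
          (Sum.inr k : Endo.{v} V) = idFun V _ := map_idFun H total V
        refine (congrArg (fun t => compFun t (f ≫ idFun V _)) (e F)).trans
          (Eq.trans ?_ (congrArg (fun t => compFun (f ≫ idFun V _) t) (e G)).symm)
        rw [idFun_compFun, compFun_idFun]
  exact ⟨⟨app, fun X Y => WeilSpace.hom_ext fun V a => key X Y V a⟩, point_const f⟩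

instance : (toPre θ).Faithful where
  map_injective h := natTrans_ext (congrArg PreDiffBundle.Hom.f h)

instance : (toPre θ).Full where
  map_surjective {F G} f := by
    have key (g : F.toEnrichedFunctor.obj total ⟶ G.toEnrichedFunctor.obj total)
        (hg : g ≫ lift G ≫ (θ.θ _).hom = (lift F ≫ (θ.θ _).hom) ≫ 𝕋.T.map g) :
        g ≫ lift G = lift F ≫ Weil1.W ⊴ₗ g := by
      rw [← cancel_mono (θ.θ _).hom, Category.assoc, hg, Category.assoc, Category.assoc,
        θ.naturality]
    obtain ⟨α, hα⟩ := exists_mapTotal_eq (F := F) (G := G) f.f (key f.f f.comm)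
    exact ⟨α, PreDiffBundle.Hom.ext hα⟩

theorem exists_inverse_toPre : ∃ Ψ : PreDiffBundle 𝕋 ⥤ LambdaFunctors C,
    toPre θ ⋙ Ψ = 𝟭 (LambdaFunctors C) ∧ Ψ ⋙ toPre θ = 𝟭 (PreDiffBundle 𝕋) :=
  exists_inverse_of_fullyFaithful (toPre θ) (fun P => (ofPreData θ P).functor)
    (toPreObj_functor_ofPreData θ) (functor_ofPreData_toPreObj θ)

end LambdaFunctors

theorem mainTheorem9 {C : Type u} [Category.{v} C] (𝕋 : TangentStructure C)
    (hE : 𝕋.HasTEqualizers) (hP : 𝕋.HasTPullbacks) :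
    (∃ _ : Reflective (DiffBundle.incl 𝕋),
      IsEqualizerReflection (𝟭 (PreDiffBundle 𝕋)) (DiffBundle.incl 𝕋)) ∧
    ∀ [MonoidalLeftAction Weil1 C] [IsTangentAction C] (θ : WeilPresentation 𝕋),
      ∃ Ψ : PreDiffBundle 𝕋 ⥤ LambdaFunctors C,
        LambdaFunctors.toPre θ ⋙ Ψ = 𝟭 (LambdaFunctors C) ∧
        Ψ ⋙ LambdaFunctors.toPre θ = 𝟭 (PreDiffBundle 𝕋) ∧
        ∃ _ : Reflective (DiffBundle.incl 𝕋 ⋙ Ψ),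
          IsEqualizerReflection (LambdaFunctors.toPre θ) (DiffBundle.incl 𝕋 ⋙ Ψ) := by
  obtain ⟨R⟩ := PreDiffBundle.exists_reflective hE hP
  refine ⟨⟨R, PreDiffBundle.isEqualizerReflection (𝟭 _) _ (Functor.rightUnitor _) hE hP⟩, ?_⟩
  intro _ _ θ
  obtain ⟨Ψ, h₁, h₂⟩ := LambdaFunctors.exists_inverse_toPre θ
  let e : PreDiffBundle 𝕋 ≌ LambdaFunctors C :=
    CategoryTheory.Equivalence.mk Ψ (LambdaFunctors.toPre θ) (eqToIso h₂.symm) (eqToIso h₁)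
  have : Ψ.IsEquivalence := inferInstanceAs e.functor.IsEquivalence
  have : (LambdaFunctors.toPre θ).IsEquivalence := inferInstanceAs e.inverse.IsEquivalence
  let _ : Reflective Ψ := { L := LambdaFunctors.toPre θ, adj := e.symm.toAdjunction }
  refine ⟨Ψ, h₁, h₂, inferInstance, ?_⟩
  refine PreDiffBundle.isEqualizerReflection _ _ (eqToIso ?_) hE hP
  rw [Functor.assoc, h₂, Functor.comp_id]
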